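/- Let $n\ge 2$ and let $\mathfrak g=\mathfrak{sl}(n,\mathbb C)$ with its Chevalley basis $H_i=E_{i,i}-E_{i+1,i+1}$ $(1\le i\le n-1)$, $E_{i,j}$ $(1\le i\ne j\le n)$, let $\mathfrak h$ be the Cartan subalgebra of diagonal matrices, and let $\mathscr W$ be the Weyl group acting on $\mathfrak h^*$, generated by the reflections $\mu\mapsto\mu-\mu(E_{i,i}-E_{j,j})(\varepsilon_i-\varepsilon_j)$, $i\neq j$, where $\varepsilon_i(h)=h_{i,i}$. Let $\phi:\mathfrak g\to\mathfrak{gl}(V)$ be a finite-dimensional complex representation. With indeterminates $z_0$, $z_{i,i}$ $(1\le i\le n-1)$, $z_{i,j}$ $(1\le i\neq j\le n)$ and $L=\sum_i z_{i,i}H_i+\sum_{i\ne j}z_{i,j}E_{i,j}$, put $\phi(L)=\sum_i z_{i,i}\phi(H_i)+\sum_{i\neq j}z_{i,j}\phi(E_{i,j})$ and $$f_\phi(z_0,L)=\det\bigl(z_0I+\phi(L)\bigr)\in\mathbb C[z_0,z_{i,i},z_{i,j}].$$ A dominant weight of $V$ is a $\mu\in\mathfrak h^*$ whose weight space $\{v\in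 V:\phi(h)v=\mu(h)v\ \text{for all } h\in\mathfrak h\}$ is nonzero and which satisfies $\mu(H_i)\in\mathbb Z_{\ge 0}$ for all $i$; its multiplicity $m(\mu)$ is the dimension of that weight space, and $O_\mu=\mathscr W\mu$ is its (finite) orbit. Then $V$ has only finitely many dominant weights $\mu_1,\dots,\mu_s$. For each of them there is exactly one polynomial $f_{\mu_i}\in\mathbb C[z_0,z_{i,i},z_{i,j}]$ (the orbital factor) such that, for all complex values of the indeterminates, if $\theta_1,\dots,\theta_n$ are the eigenvalues of $L$ listed with multiplicity in any order, then $$f_{\mu_i}(z_0,L)=\prod_{\nu\in O_{\mu_i}}\Bigl(z_0+\sum_{k=1}^{n-1}(\theta_1+\cdots+\theta_k)\,\nu(H_k)\Bigr).$$ Each $f_{\mu_i}$ is irreducible over $\mathbb C$, its total degree and its degree in $z_0$ are both equal to $|O_{\mu_i}|$, and $$f_\phi(z_0,L)=\prod_{i=1}^{s}f_{\mu_i}^{\,m(\mu_i)}.$$ -/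

import Mathlib

attribute [local instance 100] LieRing.ofAssociativeRing

noncomputable section

namespace SlCharPoly

open LieAlgebra.SpecialLinear

/-- Index set of the Chevalley basis of `sl(n, ℂ)`: the simple coroots `H_i` (`n - 1` of them) and
the root vectors `E_{i,j}` with `i ≠ j`. -/
abbrev ChevIndex (n : ℕ) : Type := Fin (n - 1) ⊕ {p : Fin n × Fin n // p.1 ≠ p.2}

/-- Indeterminates of the characteristic polynomial: `none` is `z₀`, and `some b` is the coordinate
belonging to the basis vector `b`. -/
abbrev Var (n : ℕ) : Type := Option (ChevIndex n)

/-- The element `E_{i,i} - E_{j,j}` of `sl(n, ℂ)`. -/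
def coroot {n : ℕ} (i j : Fin n) : sl (Fin n) ℂ := singleSubSingle i j 1

/-- `H_i = E_{i,i} - E_{i+1,i+1}`. -/
def simpleCoroot {n : ℕ} (i : Fin (n - 1)) : sl (Fin n) ℂ :=
  coroot ⟨i.1, by omega⟩ ⟨i.1 + 1, by omega⟩

/-- The Chevalley basis of `sl(n, ℂ)`. -/
def chevVec {n : ℕ} : ChevIndex n → sl (Fin n) ℂ
  | Sum.inl i => simpleCoroot i
  | Sum.inr p => single p.1.1 p.1.2 p.2 1

/-- The characteristic polynomial
`f_φ = det (z₀ I + ∑_b z_b φ(b)) ∈ ℂ[z₀, z_b]`, the determinant being that of an endomorphism of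
the free module `ℂ[z₀, z_b] ⊗ V`. -/
def charPoly {n : ℕ} {V : Type*} [AddCommGroup V] [Module ℂ V]
    (φ : sl (Fin n) ℂ →ₗ⁅ℂ⁆ Module.End ℂ V) : MvPolynomial (Var n) ℂ :=
  LinearMap.det
    ((MvPolynomial.X (none : Var n) : MvPolynomial (Var n) ℂ) •
        (LinearMap.id :
          TensorProduct ℂ (MvPolynomial (Var n) ℂ) V →ₗ[MvPolynomial (Var n) ℂ]
            TensorProduct ℂ (MvPolynomial (Var n) ℂ) V) +
      ∑ b : ChevIndex n, (MvPolynomial.X (some b : Var n) : MvPolynomial (Var n) ℂ) •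
        LinearMap.baseChange (MvPolynomial (Var n) ℂ) (φ (chevVec b)))

/-- The Cartan subalgebra `𝔥` of diagonal matrices in `sl(n, ℂ)`. -/
def cartan (n : ℕ) : LieSubalgebra ℂ (sl (Fin n) ℂ) where
  carrier := {A | A.1.IsDiag}
  zero_mem' := Matrix.isDiag_zero
  add_mem' ha hb := Matrix.IsDiag.add ha hb
  smul_mem' c _ ha := Matrix.IsDiag.smul c ha
  lie_mem' := by
    intro a b ha hb
    have hb' := (Matrix.isDiag_iff_diagonal_diag b.1).1 hb
    have ha' := (Matrix.isDiag_iff_diagonal_diag a.1).1 ha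
    change (⁅a, b⁆ : sl (Fin n) ℂ).1.IsDiag
    rw [sl_bracket, ← ha', ← hb', Matrix.diagonal_mul_diagonal, Matrix.diagonal_mul_diagonal]
    exact (Matrix.isDiag_diagonal _).sub (Matrix.isDiag_diagonal _)

/-- `E_{i,i} - E_{j,j}` as an element of `𝔥`. -/
def cartanCoroot {n : ℕ} (i j : Fin n) : cartan n :=
  ⟨coroot i j, by
    change (singleSubSingle i j (1 : ℂ)).1.IsDiag
    rw [val_singleSubSingle]
    intro a b hab
    simp only [Matrix.sub_apply, Matrix.single_apply]
    grind⟩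

/-- `H_i` as an element of `𝔥`. -/
def cartanSimpleCoroot {n : ℕ} (i : Fin (n - 1)) : cartan n :=
  cartanCoroot ⟨i.1, by omega⟩ ⟨i.1 + 1, by omega⟩

/-- The roots `ε_i - ε_j ∈ 𝔥*`, sending `h` to `h_{i,i} - h_{j,j}`. -/
def root {n : ℕ} (i j : Fin n) : Module.Dual ℂ (cartan n) where
  toFun h := h.1.1 i i - h.1.1 j j
  map_add' x y := by
    change (x.1.1 i i + y.1.1 i i) - (x.1.1 j j + y.1.1 j j) = _
    ring
  map_smul' c x := by
    change c * x.1.1 i i - c * x.1.1 j j = c * _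
    ring

theorem root_cartanCoroot {n : ℕ} {i j : Fin n} (hij : i ≠ j) :
    Module.Dual.eval ℂ (cartan n) (cartanCoroot i j) (root i j) = 2 := by
  change (singleSubSingle i j (1 : ℂ)).1 i i - (singleSubSingle i j (1 : ℂ)).1 j j = 2
  rw [val_singleSubSingle]
  simp [hij, hij.symm]
  norm_num

/-- The reflection `μ ↦ μ - μ(h_α) α` of `𝔥*` in the root `α = ε_i - ε_j`. -/
def rootReflection {n : ℕ} {i j : Fin n} (hij : i ≠ j) :
    Module.Dual ℂ (cartan n) ≃ₗ[ℂ] Module.Dual ℂ (cartan n) :=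
  Module.reflection (root_cartanCoroot hij)

/-- The Weyl group of `sl(n, ℂ)`, generated by the root reflections of `𝔥*`. -/
def weylGroup (n : ℕ) : Subgroup (Module.Dual ℂ (cartan n) ≃ₗ[ℂ] Module.Dual ℂ (cartan n)) :=
  Subgroup.closure {g | ∃ (i j : Fin n) (hij : i ≠ j), g = rootReflection hij}

/-- The orbit `O_μ` of `μ` under the Weyl group. -/
def weylOrbit {n : ℕ} (μ : Module.Dual ℂ (cartan n)) : Set (Module.Dual ℂ (cartan n)) :=
  MulAction.orbit (weylGroup n) μ

/-- The weight space `{v | φ(h) v = μ(h) v for all h ∈ 𝔥}`. -/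
def weightSpace {n : ℕ} {V : Type*} [AddCommGroup V] [Module ℂ V]
    (φ : sl (Fin n) ℂ →ₗ⁅ℂ⁆ Module.End ℂ V) (μ : Module.Dual ℂ (cartan n)) : Submodule ℂ V :=
  ⨅ h : cartan n, Module.End.eigenspace (φ h.1) (μ h)

/-- The multiplicity of the weight `μ`. -/
def weightMult {n : ℕ} {V : Type*} [AddCommGroup V] [Module ℂ V]
    (φ : sl (Fin n) ℂ →ₗ⁅ℂ⁆ Module.End ℂ V) (μ : Module.Dual ℂ (cartan n)) : ℕ :=
  Module.finrank ℂ (weightSpace φ μ)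

/-- The dominant weights of the representation: those weights `μ` with `μ(H_i) ∈ ℕ` for all `i`. -/
def dominantWeights {n : ℕ} {V : Type*} [AddCommGroup V] [Module ℂ V]
    (φ : sl (Fin n) ℂ →ₗ⁅ℂ⁆ Module.End ℂ V) : Set (Module.Dual ℂ (cartan n)) :=
  {μ | weightSpace φ μ ≠ ⊥ ∧ ∀ i : Fin (n - 1), ∃ k : ℕ, μ (cartanSimpleCoroot i) = k}

/-- The element `L = ∑_b z_b b` of `sl(n, ℂ)` with coordinates `z`. -/
def elementAt {n : ℕ} (z : Var n → ℂ) : sl (Fin n) ℂ :=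
  ∑ b : ChevIndex n, z (some b) • chevVec b

/-- `∑_i (θ_1 + ⋯ + θ_i) H_i ∈ 𝔥`, which is `diag (θ_1, …, θ_n)` when `∑ θ_j = 0`. -/
def diagElement {n : ℕ} (θ : Fin n → ℂ) : cartan n :=
  ∑ i : Fin (n - 1), (∑ j : Fin n with j.1 ≤ i.1, θ j) • cartanSimpleCoroot i

/-- `P` is the orbital factor of `μ`: whenever `L = ∑_b z_b b` has eigenvalues `θ_1, …, θ_n`
(with multiplicity, in any order),
`P(z₀, z) = ∏_{ν ∈ O_μ} (z₀ + ν (∑_i (θ_1 + ⋯ + θ_i) H_i))`. -/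
def IsOrbitalFactor {n : ℕ} (μ : Module.Dual ℂ (cartan n)) (P : MvPolynomial (Var n) ℂ) : Prop :=
  ∀ (z : Var n → ℂ) (θ : Fin n → ℂ),
    (elementAt z).1.charpoly = ∏ i : Fin n, (Polynomial.X - Polynomial.C (θ i)) →
      MvPolynomial.eval z P = ∏ᶠ ν ∈ weylOrbit μ, (z none + ν (diagElement θ))

end SlCharPoly

end

/-!
The proof has two halves.

*Weights.* In a finite-dimensional representation of `sl₂` with standard elements `e`, `f`, `h`,
the products `f ^ k * e ^ k` and `e ^ k * f ^ k` are products of linear polynomials in the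
commuting elements `f * e` and `h`. For large `k` both vanish, and the resulting two families of
lines meet transversally in points with integral `h`-coordinate (`prod_sub_intCast_eq_zero`), so
`h` is semisimple with integral eigenvalues. Applied to all coroots, this gives the weight
decomposition of `V` and the splitting of `det (z₀ + φ(h))` on the Cartan subalgebra
(`det_map_cartan`). Conjugation by an elementary matrix `1 + t E_{i,j}` is `exp (ad (t E_{i,j}))`,
hence is intertwined with `φ` by `exp (φ (t E_{i,j}))`; since an invertible matrix is a product of
elementary matrices and one diagonal matrix, every element with distinct eigenvalues can be
diagonalised by a conjugation that lifts to `V` (`det_map_of_charpoly`), and multiplicities are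
constant on Weyl orbits (`weightMult_eq_of_mem_weylOrbit`). Each orbit of weights contains exactly
one dominant weight, found by sorting coefficients. As the discriminant is a nonzero polynomial,
the factorization holds identically (`charPoly_eq_prod`).

*Orbital factors.* The Weyl group permutes the coefficients of a weight, so `∏_{ν ∈ O_μ} (z₀ +
ν(θ))` is symmetric in `θ` and, by the fundamental theorem on symmetric polynomials, a polynomial
in the coefficients of the characteristic polynomial of `L` (`exists_lift_of_isSymmetric`). For
irreducibility, a factor is restricted to the companion matrix of `∏ (X - θ_i)`, with generic `θ`
of sum zero. The entries of that matrix are symmetric in `θ`, so the restricted factor is fixed by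
all permutations; these are transitive on the `|O_μ|` distinct roots `-ν(θ)` of the orbital
factor, so a factor with one of these roots has all of them and the complementary factor is
constant (`irreducible_orbitalFactor`).
-/

/-! ### Representations of `sl₂` -/

namespace SlCharPoly

section SlTwo

section Ring

variable {A : Type*} [Ring A]

theorem sl_two_h_mul_pow {e h : A} (he : h * e - e * h = 2 * e) (k : ℕ) :
    h * e ^ k = e ^ k * (h + 2 * k) := by
  have he' : h * e = e * (h + 2) := by
    rw [sub_eq_iff_eq_add] at he
    rw [he]; noncomm_ring
  induction k with
  | zero => simp
  | succ k ih =>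
    rw [pow_succ, ← mul_assoc, ih, mul_assoc, add_mul, he', mul_assoc (e ^ k)]
    congr 1
    push_cast
    have : (k : A) * e = e * k := Nat.cast_commute k e
    rw [mul_assoc, this]
    noncomm_ring

theorem sl_two_fe_mul_pow {e f h : A} (hef : e * f - f * e = h) (he : h * e - e * h = 2 * e)
    (k : ℕ) : f * e * e ^ k = e ^ k * (f * e - k * (h + k + 1)) := by
  have he' : h * e = e * (h + 2) := by
    rw [sub_eq_iff_eq_add] at he
    rw [he]; noncomm_ring
  have hF : f * e * e = e * (f * e - h - 2) := by
    have h1 : f * e = e * f - h := by rw [← hef]; abel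
    rw [h1, sub_mul, he']
    rw [← hef]
    noncomm_ring
  induction k with
  | zero => simp
  | succ k ih =>
    have hk : (k : A) * e = e * k := Nat.cast_commute k e
    have hkh : (k : A) * h = h * k := Nat.cast_commute k h
    rw [pow_succ, ← mul_assoc, ih, mul_assoc, mul_assoc]
    congr 1
    have h2 : (k : A) * (h + k + 1) * e = e * (k * (h + (1 + 1) + k + 1)) := by
      have h3 : (k : A) * (h + k + 1) * e = k * (h * e) + k * (k * e) + k * e := by noncomm_ring
      rw [h3, he', hk, ← mul_assoc, ← mul_assoc, hk, ← one_add_one_eq_two]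
      noncomm_ring
    rw [sub_mul, hF, h2, ← mul_sub]
    congr 1
    push_cast
    rw [← one_add_one_eq_two]
    noncomm_ring

/-- The product `f ^ k * e ^ k` as a polynomial in the commuting elements `f * e` and `h`. -/
theorem sl_two_pow_mul_pow {e f h : A} (hef : e * f - f * e = h) (he : h * e - e * h = 2 * e)
    {S : Type*} [CommRing S] (ι : S →+* A) {F H : S} (hF : ι F = f * e) (hH : ι H = h) (k : ℕ) :
    f ^ k * e ^ k = ι (∏ i ∈ Finset.range k, (F - i * (H + i + 1))) := by
  induction k with
  | zero => simp
  | succ k ih =>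
    rw [Finset.prod_range_succ, map_mul, ← ih, pow_succ, pow_succ', mul_assoc, ← mul_assoc f,
      sl_two_fe_mul_pow hef he, ← mul_assoc]
    simp [hF, hH]

end Ring

/-- The two families of lines `F = i (H + i + 1)` and `F = -(j + 1) (H - j)` in the `(H, F)`-plane
meet transversally, in points with `H = j - i`, and no such point lies on two lines of the same
family. Hence the products of the two families together force `H` to satisfy a polynomial with
simple integral roots. -/
theorem prod_sub_intCast_eq_zero {S : Type*} [CommRing S] (hu : ∀ k : ℕ, k ≠ 0 → IsUnit (k : S))
    {F H : S} {N : ℕ} (h1 : ∏ i ∈ Finset.range N, (F - i * (H + i + 1)) = 0)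
    (h2 : ∏ j ∈ Finset.range N, (F + (j + 1) * (H - j)) = 0) :
    ∏ k ∈ Finset.Ioo (-N : ℤ) N, (H - k) = 0 := by
  set P := ∏ k ∈ Finset.Ioo (-N : ℤ) N, (H - k) with hP
  -- Suppose the annihilator of `P` is proper, and work modulo a maximal ideal containing it.
  by_contra hne
  have hann : Ideal.span {P} ≠ ⊥ := by simpa using hne
  have hI : (Submodule.annihilator (Ideal.span {P})) ≠ ⊤ := by
    rwa [Ne, Submodule.annihilator_eq_top_iff]
  obtain ⟨m, hm, hle⟩ := Ideal.exists_le_maximal _ hI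
  have hmp := hm.isPrime
  have hmem (x : S) (hx : x * P = 0) : x ∈ m := by
    apply hle
    rw [Submodule.mem_annihilator_span_singleton]
    exact hx
  have hnat (k : ℕ) (hk : k ≠ 0) : (k : S) ∉ m := fun hk' =>
    hm.ne_top (Ideal.eq_top_of_isUnit_mem _ hk' (hu k hk))
  have hint (k : ℤ) (hk : k ≠ 0) : (k : S) ∉ m := by
    intro hk'
    refine hnat k.natAbs (by simpa using hk) ?_
    rcases Int.natAbs_eq k with h | h <;> rw [h] at hk'
    · simpa using hk'
    · rw [Int.cast_neg, neg_mem_iff] at hk'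
      simpa using hk'
  obtain ⟨i, hi, him⟩ := (hmp.prod_mem_iff).1 (h1 ▸ m.zero_mem)
  obtain ⟨j, hj, hjm⟩ := (hmp.prod_mem_iff).1 (h2 ▸ m.zero_mem)
  have hH : H - ((j : ℤ) - i : ℤ) ∈ m := by
    have h3 := m.sub_mem hjm him
    have h4 : F + (j + 1) * (H - j) - (F - i * (H + i + 1)) =
        ((i + j + 1 : ℕ) : S) * (H - ((j : ℤ) - i : ℤ)) := by push_cast; ring
    rw [h4] at h3
    exact (hmp.mem_or_mem h3).resolve_left (hnat _ (by omega))
  set s := ∏ i' ∈ (Finset.range N).erase i, (F - i' * (H + i' + 1)) with hs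
  set t := ∏ j' ∈ (Finset.range N).erase j, (F + (j' + 1) * (H - j')) with ht
  have hs' : s ∉ m := by
    intro hsm
    obtain ⟨i', hi', him'⟩ := (hmp.prod_mem_iff).1 hsm
    have hne' : i' ≠ i := (Finset.mem_erase.1 hi').1
    have h3 := m.sub_mem him him'
    have h4 : F - i * (H + i + 1) - (F - i' * (H + i' + 1)) =
        ((i' - i : ℤ) : S) * (H + i + i' + 1) := by push_cast; ring
    rw [h4] at h3
    have h5 := m.sub_mem ((hmp.mem_or_mem h3).resolve_left (hint _ (by omega))) hH
    refine hnat (j + i' + 1) (by omega) ?_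
    convert h5 using 1
    push_cast; ring
  have ht' : t ∉ m := by
    intro htm
    obtain ⟨j', hj', hjm'⟩ := (hmp.prod_mem_iff).1 htm
    have hne' : j' ≠ j := (Finset.mem_erase.1 hj').1
    have h3 := m.sub_mem hjm hjm'
    have h4 : F + (j + 1) * (H - j) - (F + (j' + 1) * (H - j')) =
        ((j - j' : ℤ) : S) * (H - j - j' - 1) := by push_cast; ring
    rw [h4] at h3
    have h5 := m.sub_mem hH ((hmp.mem_or_mem h3).resolve_left (hint _ (by omega)))
    refine hnat (i + j' + 1) (by omega) ?_
    convert h5 using 1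
    push_cast; ring
  have hsa : (F - i * (H + i + 1)) * s = 0 := by
    rw [hs, Finset.mul_prod_erase (Finset.range N) (fun i' : ℕ => F - i' * (H + i' + 1)) hi, h1]
  have htb : (F + (j + 1) * (H - j)) * t = 0 := by
    rw [ht, Finset.mul_prod_erase (Finset.range N) (fun j' : ℕ => F + (j' + 1) * (H - j')) hj, h2]
  have hst : s * t * P = 0 := by
    have hk : ((j : ℤ) - i : ℤ) ∈ Finset.Ioo (-N : ℤ) N := by
      simp only [Finset.mem_range] at hi hj
      simp only [Finset.mem_Ioo]; omega
    rw [hP, ← Finset.mul_prod_erase _ _ hk, ← mul_assoc]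
    have h4 : ((i + j + 1 : ℕ) : S) * (s * t * (H - ((j : ℤ) - i : ℤ))) = 0 := by
      have : ((i + j + 1 : ℕ) : S) * (s * t * (H - ((j : ℤ) - i : ℤ))) =
        s * ((F + (j + 1) * (H - j)) * t) - t * ((F - i * (H + i + 1)) * s) := by
          push_cast; ring
      rw [this, hsa, htb]; ring
    rw [(hu (i + j + 1) (by omega)).mul_right_eq_zero.1 h4, zero_mul]
  rcases hmp.mem_or_mem (hmem _ hst) with h | h
  · exact hs' h
  · exact ht' h

variable {V : Type*} [AddCommGroup V] [Module ℂ V] [FiniteDimensional ℂ V]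

/-- All powers of `e` are eigenvectors of `ad h`, with distinct eigenvalues, so they cannot all be
nonzero. -/
theorem isNilpotent_of_commutator_eq {e h : Module.End ℂ V} (he : h * e - e * h = 2 * e) :
    IsNilpotent e := by
  by_contra hn
  simp only [IsNilpotent, not_exists] at hn
  let D : Module.End ℂ (Module.End ℂ V) := LinearMap.mulLeft ℂ h - LinearMap.mulRight ℂ h
  have hD (k : ℕ) : D.HasEigenvalue (2 * k : ℂ) := by
    refine Module.End.hasEigenvalue_of_hasEigenvector (x := e ^ k) ⟨?_, hn k⟩
    rw [Module.End.mem_eigenspace_iff]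
    simp only [D, LinearMap.sub_apply, LinearMap.mulLeft_apply, LinearMap.mulRight_apply]
    rw [sl_two_h_mul_pow he, mul_add, add_sub_cancel_left]
    rw [show (2 * k : Module.End ℂ V) = algebraMap ℂ _ (2 * k : ℂ) by
        rw [map_mul, map_natCast, map_ofNat],
      ← Algebra.commutes, Algebra.smul_def]
  have hfin := D.finite_hasEigenvalue
  refine Set.infinite_of_injective_forall_mem (f := fun k : ℕ => (2 * k : ℂ)) ?_ hD hfin
  intro a b hab
  simpa using hab

open scoped IsMulCommutative in
/-- In a finite-dimensional representation of `sl₂` the coroot satisfies a polynomial with simple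
integral roots. -/
theorem exists_prod_sub_intCast_eq_zero {e f h : Module.End ℂ V} (hef : e * f - f * e = h)
    (he : h * e - e * h = 2 * e) (hf : h * f - f * h = -(2 * f)) :
    ∃ N : ℕ, Polynomial.aeval h
      (∏ k ∈ Finset.Ioo (-N : ℤ) N, (Polynomial.X - Polynomial.C (k : ℂ))) = 0 := by
  have hf' : -h * f - f * -h = 2 * f := by
    rw [neg_mul, mul_neg, sub_neg_eq_add, ← neg_inj, ← hf]; abel
  have hfe : f * e - e * f = -h := by rw [← hef]; abel
  obtain ⟨a, ha⟩ := isNilpotent_of_commutator_eq he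
  obtain ⟨b, hb⟩ := isNilpotent_of_commutator_eq hf'
  have hcomm : Commute h (f * e) := by
    have h1 : h * e = e * h + 2 * e := by rw [← he]; abel
    have h2 : h * f = f * h - 2 * f := by rw [sub_eq_add_neg, ← hf]; abel
    change h * (f * e) = f * e * h
    rw [← mul_assoc, h2, sub_mul, mul_assoc, h1]
    noncomm_ring
  -- The commutative algebra generated by `h` and `f * e`.
  have hc : ∀ x ∈ ({h, f * e} : Set (Module.End ℂ V)), ∀ y ∈ ({h, f * e} : Set (Module.End ℂ V)),
      x * y = y * x := by
    rintro x (rfl | rfl) y (rfl | rfl)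
    · rfl
    · exact hcomm
    · exact hcomm.symm
    · rfl
  have := Algebra.isMulCommutative_adjoin ℂ hc
  set S := Algebra.adjoin ℂ ({h, f * e} : Set (Module.End ℂ V)) with hS
  let ι : S →+* Module.End ℂ V := S.val.toRingHom
  have hι : Function.Injective ι := Subtype.val_injective
  let H : S := ⟨h, Algebra.subset_adjoin (by simp)⟩
  let F : S := ⟨f * e, Algebra.subset_adjoin (by simp)⟩
  have hu (k : ℕ) (hk : k ≠ 0) : IsUnit (k : S) := by
    have : (k : S) * algebraMap ℂ S (k : ℂ)⁻¹ = 1 := by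
      apply hι
      rw [map_mul, map_natCast, map_one]
      change (k : Module.End ℂ V) * algebraMap ℂ _ (k : ℂ)⁻¹ = 1
      rw [← map_natCast (algebraMap ℂ (Module.End ℂ V)), ← map_mul,
        mul_inv_cancel₀ (by exact_mod_cast hk), map_one]
    exact IsUnit.of_mul_eq_one _ this
  refine ⟨max a b, ?_⟩
  have hea : e ^ max a b = 0 := pow_eq_zero_of_le (le_max_left _ _) ha
  have hfb : f ^ max a b = 0 := pow_eq_zero_of_le (le_max_right _ _) hb
  have key := prod_sub_intCast_eq_zero hu (F := F) (H := H) (N := max a b) ?_ ?_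
  · refine (Polynomial.aeval_algHom_apply S.val H _).trans ?_
    simp only [map_prod, map_sub, Polynomial.aeval_X, map_intCast]
    exact (congrArg S.val key).trans (map_zero _)
  · apply hι
    rw [← sl_two_pow_mul_pow hef he ι (F := F) (H := H) rfl rfl, hea, mul_zero, map_zero]
  · apply hι
    -- The triple `(f, e, -h)` satisfies the same relations, with `e * f = f * e + h`.
    have h3 := sl_two_pow_mul_pow hfe hf' ι (F := F + H) (H := -H) (by
      rw [map_add]; change f * e + h = e * f; rw [← hef]; abel) (by rw [map_neg]; rfl) (max a b)
    rw [hea, zero_mul] at h3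
    rw [map_zero, h3]
    congr 1
    refine Finset.prod_congr rfl fun i _ => ?_
    ring

theorem isSemisimple_of_sl_two {e f h : Module.End ℂ V} (hef : e * f - f * e = h)
    (he : h * e - e * h = 2 * e) (hf : h * f - f * h = -(2 * f)) : h.IsSemisimple := by
  obtain ⟨N, hN⟩ := exists_prod_sub_intCast_eq_zero hef he hf
  refine Module.End.isSemisimple_of_squarefree_aeval_eq_zero ?_ hN
  refine Polynomial.Separable.squarefree ?_
  rw [Polynomial.separable_prod_X_sub_C_iff']
  intro x _ y _ hxy
  exact_mod_cast hxy

theorem exists_intCast_of_sl_two {e f h : Module.End ℂ V} (hef : e * f - f * e = h)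
    (he : h * e - e * h = 2 * e) (hf : h * f - f * h = -(2 * f)) {c : ℂ}
    (hc : h.HasEigenvalue c) : ∃ k : ℤ, c = k := by
  obtain ⟨N, hN⟩ := exists_prod_sub_intCast_eq_zero hef he hf
  obtain ⟨v, hv⟩ := hc.exists_hasEigenvector
  have h1 := Module.End.aeval_apply_of_hasEigenvector (p := ∏ k ∈ Finset.Ioo (-N : ℤ) N,
    (Polynomial.X - Polynomial.C (k : ℂ))) hv
  rw [hN, LinearMap.zero_apply, eq_comm, smul_eq_zero, or_iff_left hv.2,
    Polynomial.eval_prod, Finset.prod_eq_zero_iff] at h1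
  obtain ⟨k, -, hk⟩ := h1
  exact ⟨k, by simpa [sub_eq_zero] using hk⟩

end SlTwo

end SlCharPoly

/-! ### Automorphisms of `V` over conjugation by elementary matrices -/

namespace SlCharPoly

open LieAlgebra.SpecialLinear

section Exp

/-- Conjugation by the exponential of a nilpotent `a` is `exp (ad a)`, which on elements killed by
`(ad a) ^ 3` is a quadratic expression. -/
theorem exists_unit_mul_eq {A : Type*} [Ring A] [Algebra ℂ A] {a : A} (ha : IsNilpotent a) :
    ∃ g : Aˣ, ∀ x : A, ⁅a, ⁅a, ⁅a, x⁆⁆⁆ = 0 →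
      g * x = (x + ⁅a, x⁆ + (2⁻¹ : ℂ) • ⁅a, ⁅a, x⁆⁆) * g := by
  let _ : Module ℚ A := Module.compHom A (algebraMap ℚ ℂ)
  have hsmul (q : ℚ) (x : A) : q • x = (q : ℂ) • x := rfl
  refine ⟨⟨IsNilpotent.exp a, IsNilpotent.exp (-a), IsNilpotent.exp_mul_exp_neg_self ha,
    IsNilpotent.exp_neg_mul_exp_self ha⟩, fun x hx => ?_⟩
  let l : Module.End ℂ A := LinearMap.mulLeft ℂ a
  let r : Module.End ℂ A := LinearMap.mulRight ℂ a
  have hl : IsNilpotent l := (LinearMap.isNilpotent_mulLeft_iff ℂ a).2 ha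
  have hr : IsNilpotent r := (LinearMap.isNilpotent_mulRight_iff ℂ a).2 ha
  -- `exp l = exp r * exp (l - r)`, and `l - r` is `ad a`.
  have hlr : Commute l r := LinearMap.ext fun c => (mul_assoc a c a).symm
  let D : Module.End ℂ A := l - r
  have hD (y : A) : D y = ⁅a, y⁆ := rfl
  have hDn : IsNilpotent D := hlr.isNilpotent_sub hl hr
  have hDr : Commute D r := hlr.sub_left (Commute.refl r)
  have h1 : IsNilpotent.exp l = IsNilpotent.exp r * IsNilpotent.exp D := by
    rw [← IsNilpotent.exp_add_of_commute hDr.symm hr hDn]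
    congr 1
    simp [D]
  obtain ⟨k, hk⟩ := ha
  have hlk : l ^ k = 0 := by simp [l, LinearMap.pow_mulLeft, hk]
  have hrk : r ^ k = 0 := by simp [r, LinearMap.pow_mulRight, hk]
  have h2 (y : A) : IsNilpotent.exp l y = IsNilpotent.exp a * y := by
    rw [IsNilpotent.exp_eq_sum hlk, IsNilpotent.exp_eq_sum hk, Finset.sum_mul]
    simp [l, LinearMap.pow_mulLeft, hsmul, LinearMap.sum_apply]
  have h3 (y : A) : IsNilpotent.exp r y = y * IsNilpotent.exp a := by
    rw [IsNilpotent.exp_eq_sum hrk, IsNilpotent.exp_eq_sum hk, Finset.mul_sum]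
    simp [r, LinearMap.pow_mulRight, hsmul, LinearMap.sum_apply]
  have h4 : IsNilpotent.exp D x = x + ⁅a, x⁆ + (2⁻¹ : ℂ) • ⁅a, ⁅a, x⁆⁆ := by
    have h5 : (D ^ 3) • x = 0 := hx
    have h6 := IsNilpotent.exp_smul_eq_sum h5 hDn
    rw [Finset.sum_range_succ, Finset.sum_range_succ, Finset.sum_range_one] at h6
    refine h6.trans ?_
    simp only [hsmul]
    simp [pow_two, hD]
  change IsNilpotent.exp a * x = _ * IsNilpotent.exp a
  rw [← h2, h1, ← h4, ← h3]
  rfl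

end Exp

section Lift

variable {n : ℕ} {V : Type*} [AddCommGroup V] [Module ℂ V]

theorem trace_coe (A : sl (Fin n) ℂ) : A.1.trace = 0 :=
  LinearMap.mem_ker.1 A.2

/-- A trace-free matrix as an element of `sl(n, ℂ)`. -/
def ofTraceZero (A : Matrix (Fin n) (Fin n) ℂ) (hA : A.trace = 0) : sl (Fin n) ℂ :=
  ⟨A, LinearMap.mem_ker.2 hA⟩

/-- `T` is liftable to `V` if conjugation by `T` on `sl(n, ℂ)` is intertwined with the
representation by an automorphism of `V`. -/
def Liftable (φ : sl (Fin n) ℂ →ₗ⁅ℂ⁆ Module.End ℂ V) (T : (Matrix (Fin n) (Fin n) ℂ)ˣ) : Prop :=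
  ∃ g : (Module.End ℂ V)ˣ, ∀ A B : sl (Fin n) ℂ, A.1 * T.1 = T.1 * B.1 → φ A * g = g * φ B

theorem liftable_one (φ : sl (Fin n) ℂ →ₗ⁅ℂ⁆ Module.End ℂ V) : Liftable φ 1 :=
  ⟨1, fun A B h => by
    have : A = B := Subtype.ext (by simpa using h)
    simp [this]⟩

theorem Liftable.mul {φ : sl (Fin n) ℂ →ₗ⁅ℂ⁆ Module.End ℂ V} {S T : (Matrix (Fin n) (Fin n) ℂ)ˣ}
    (hS : Liftable φ S) (hT : Liftable φ T) : Liftable φ (S * T) := by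
  obtain ⟨g, hg⟩ := hS
  obtain ⟨k, hk⟩ := hT
  refine ⟨g * k, fun A B h => ?_⟩
  let C : sl (Fin n) ℂ := ofTraceZero (T.1 * B.1 * T⁻¹.1) (by
    rw [Matrix.trace_mul_cycle, Units.inv_mul, one_mul, trace_coe])
  have h1 : C.1 * T.1 = T.1 * B.1 := by
    change T.1 * B.1 * T⁻¹.1 * T.1 = _
    rw [mul_assoc, Units.inv_mul, mul_one]
  have h2 : A.1 * S.1 = S.1 * C.1 := by
    change _ = S.1 * (T.1 * B.1 * T⁻¹.1)
    rw [Units.val_mul, mul_assoc S.1, ← mul_assoc A.1] at h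
    rw [← mul_assoc S.1, ← h, mul_assoc (A.1 * S.1), Units.mul_inv, mul_one]
  rw [Units.val_mul, ← mul_assoc, hg _ _ h2, mul_assoc, hk _ _ h1, mul_assoc]

theorem map_lie_eq (φ : sl (Fin n) ℂ →ₗ⁅ℂ⁆ Module.End ℂ V) {A B C : sl (Fin n) ℂ}
    (h : A.1 * B.1 - B.1 * A.1 = C.1) : φ A * φ B - φ B * φ A = φ C := by
  have h1 : ⁅A, B⁆ = C := Subtype.ext (by rw [sl_bracket, h])
  rw [← h1, LieHom.map_lie]
  rfl

theorem coroot_val (i j : Fin n) :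
    (coroot i j).1 = Matrix.single i i 1 - Matrix.single j j 1 := val_singleSubSingle ..

theorem single_commutators {i j : Fin n} (hij : i ≠ j) :
    ((single i j hij (1 : ℂ)).1 * (single j i hij.symm (1 : ℂ)).1 -
      (single j i hij.symm (1 : ℂ)).1 * (single i j hij (1 : ℂ)).1 = (coroot i j).1) ∧
    ((coroot i j).1 * (single i j hij (1 : ℂ)).1 - (single i j hij (1 : ℂ)).1 * (coroot i j).1 =
      ((2 : ℂ) • single i j hij (1 : ℂ)).1) ∧
    ((coroot i j).1 * (single j i hij.symm (1 : ℂ)).1 -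
      (single j i hij.symm (1 : ℂ)).1 * (coroot i j).1 =
      (-(2 : ℂ) • single j i hij.symm (1 : ℂ)).1) := by
  have h2 : ∀ (c : ℂ) (A : sl (Fin n) ℂ), (c • A).1 = c • A.1 := fun _ _ => rfl
  simp only [coroot_val, val_single, h2]
  refine ⟨?_, ?_, ?_⟩
  · simp
  · simp only [sub_mul, mul_sub, Matrix.single_mul_single_same, ne_eq, hij.symm,
      not_false_eq_true, Matrix.single_mul_single_of_ne]
    rw [two_smul]; simp
  · simp only [sub_mul, mul_sub, Matrix.single_mul_single_same, ne_eq, hij,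
      not_false_eq_true, Matrix.single_mul_single_of_ne]
    rw [neg_smul, two_smul]; simp; abel

variable (φ : sl (Fin n) ℂ →ₗ⁅ℂ⁆ Module.End ℂ V)

theorem map_sl_two {i j : Fin n} (hij : i ≠ j) :
    (φ (single i j hij 1) * φ (single j i hij.symm 1) -
      φ (single j i hij.symm 1) * φ (single i j hij 1) = φ (coroot i j)) ∧
    (φ (coroot i j) * φ (single i j hij 1) - φ (single i j hij 1) * φ (coroot i j) =
      2 * φ (single i j hij 1)) ∧
    (φ (coroot i j) * φ (single j i hij.symm 1) - φ (single j i hij.symm 1) * φ (coroot i j) =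
      -(2 * φ (single j i hij.symm 1))) := by
  obtain ⟨h1, h2, h3⟩ := single_commutators hij
  refine ⟨map_lie_eq φ h1, (map_lie_eq φ h2).trans ?_, (map_lie_eq φ h3).trans ?_⟩
  · rw [map_smul, two_smul, two_mul]
  · rw [neg_smul, map_neg, map_smul, two_smul, two_mul]

variable [FiniteDimensional ℂ V]

theorem isNilpotent_map_single {i j : Fin n} (hij : i ≠ j) (t : ℂ) :
    IsNilpotent (φ (single i j hij t)) := by
  have h1 : single i j hij t = t • single i j hij (1 : ℂ) := by
    apply Subtype.ext
    change _ = t • (single i j hij (1 : ℂ)).1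
    simp
  rw [h1, map_smul]
  exact (isNilpotent_of_commutator_eq (map_sl_two φ hij).2.1).smul t

/-- An elementary matrix `1 + t E_{i,j}` as a unit. -/
def transvectionUnit {i j : Fin n} (hij : i ≠ j) (t : ℂ) : (Matrix (Fin n) (Fin n) ℂ)ˣ where
  val := Matrix.transvection i j t
  inv := Matrix.transvection i j (-t)
  val_inv := by simp [Matrix.transvection_mul_transvection_same, hij]
  inv_val := by simp [Matrix.transvection_mul_transvection_same, hij]

theorem liftable_transvectionUnit {i j : Fin n} (hij : i ≠ j) (t : ℂ) :
    Liftable φ (transvectionUnit hij t) := by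
  obtain ⟨g, hg⟩ := exists_unit_mul_eq (isNilpotent_map_single φ hij t)
  refine ⟨g, fun A B h => ?_⟩
  set E := single i j hij t with hE
  have hEE : E.1 * E.1 = 0 := by simp [hE, hij.symm]
  have hT : (transvectionUnit hij t).1 = 1 + E.1 := by
    simp [transvectionUnit, Matrix.transvection, hE]
  have hT' : (1 + E.1) * (1 - E.1) = 1 := by
    rw [mul_sub, mul_one, add_mul, one_mul, hEE]; abel
  have h2 : ∀ (c : ℂ) (A : sl (Fin n) ℂ), (c • A).1 = c • A.1 := fun _ _ => rfl
  have h3 : ∀ (A B : sl (Fin n) ℂ), (A + B).1 = A.1 + B.1 := fun _ _ => rfl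
  have hEE' (X : Matrix (Fin n) (Fin n) ℂ) : E.1 * (E.1 * X) = 0 := by
    rw [← mul_assoc, hEE, zero_mul]
  have h4 : ⁅E, ⁅E, ⁅E, B⁆⁆⁆ = 0 := by
    apply Subtype.ext
    simp only [sl_bracket, mul_sub, sub_mul, mul_assoc, hEE, hEE', mul_zero, zero_mul]
    change _ = (0 : Matrix (Fin n) (Fin n) ℂ)
    simp
  have hA : A = B + ⁅E, B⁆ + (2⁻¹ : ℂ) • ⁅E, ⁅E, B⁆⁆ := by
    apply Subtype.ext
    rw [hT] at h
    have h5 : A.1 = (1 + E.1) * B.1 * (1 - E.1) := by rw [← h, mul_assoc, hT', mul_one]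
    rw [h5]
    simp only [h2, h3, sl_bracket, mul_sub, sub_mul, mul_assoc, hEE, hEE', mul_zero, mul_one,
      add_mul, one_mul]
    have h6 (X : Matrix (Fin n) (Fin n) ℂ) : (2⁻¹ : ℂ) • (0 - X - (X - 0)) = -X := by
      rw [zero_sub, sub_zero, sub_eq_add_neg, ← two_smul ℂ (-X), smul_smul]; norm_num
    rw [h6]
    abel
  have h7 := hg (φ B) (by simp only [← LieHom.map_lie, h4, map_zero])
  rw [h7, hA]
  simp only [map_add, map_smul, LieHom.map_lie]

theorem liftable_list_transvec (L : List (Matrix.TransvectionStruct (Fin n) ℂ)) :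
    ∃ T : (Matrix (Fin n) (Fin n) ℂ)ˣ, Liftable φ T ∧
      T.1 = (L.map Matrix.TransvectionStruct.toMatrix).prod := by
  induction L with
  | nil => exact ⟨1, liftable_one φ, rfl⟩
  | cons t L ih =>
    obtain ⟨T, hT, hTL⟩ := ih
    refine ⟨transvectionUnit t.hij t.c * T, (liftable_transvectionUnit φ t.hij t.c).mul hT, ?_⟩
    rw [Units.val_mul, hTL]
    rfl

theorem diagonal_mul_list_transvec (d : Fin n → ℂ) (hd : ∀ i, d i ≠ 0)
    (L : List (Matrix.TransvectionStruct (Fin n) ℂ)) :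
    ∃ L' : List (Matrix.TransvectionStruct (Fin n) ℂ),
      Matrix.diagonal d * (L.map Matrix.TransvectionStruct.toMatrix).prod =
        (L'.map Matrix.TransvectionStruct.toMatrix).prod * Matrix.diagonal d := by
  induction L with
  | nil => exact ⟨[], by simp⟩
  | cons t L ih =>
    obtain ⟨L', hL'⟩ := ih
    refine ⟨⟨t.i, t.j, t.hij, d t.i * t.c / d t.j⟩ :: L', ?_⟩
    simp only [List.map_cons, List.prod_cons]
    rw [mul_assoc, ← hL', ← mul_assoc, ← mul_assoc]
    congr 1
    simp only [Matrix.TransvectionStruct.toMatrix, Matrix.transvection, mul_add, add_mul, mul_one,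
      one_mul]
    congr 1
    ext a b
    simp only [Matrix.diagonal_mul, Matrix.mul_diagonal, Matrix.single_apply]
    split_ifs with h
    · rw [← h.1, ← h.2, div_mul_cancel₀ _ (hd _)]
    · simp

/-- Moving the diagonal factor to the right, every invertible matrix is a product of elementary
matrices, which are liftable, and a diagonal matrix. -/
theorem exists_liftable_mul_diagonal (M : Matrix (Fin n) (Fin n) ℂ) (hM : M.det ≠ 0) :
    ∃ T : (Matrix (Fin n) (Fin n) ℂ)ˣ, Liftable φ T ∧ ∃ d : Fin n → ℂ,
      M = T.1 * Matrix.diagonal d := by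
  obtain ⟨L, L', d, h⟩ := Matrix.Pivot.exists_list_transvec_mul_diagonal_mul_list_transvec M
  have hd (i : Fin n) : d i ≠ 0 := by
    intro hi
    apply hM
    rw [h, Matrix.det_mul, Matrix.det_mul, Matrix.det_diagonal,
      Finset.prod_eq_zero (Finset.mem_univ i) hi]
    simp
  obtain ⟨L'', hL''⟩ := diagonal_mul_list_transvec d hd L'
  obtain ⟨T, hT, hTL⟩ := liftable_list_transvec φ (L ++ L'')
  refine ⟨T, hT, d, ?_⟩
  rw [h, hTL, mul_assoc, hL'', List.map_append, List.prod_append, mul_assoc]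

end Lift

end SlCharPoly

/-! ### Weights as vectors of coefficients, and the Weyl group -/

namespace SlCharPoly

section Weights

variable {n : ℕ}

theorem cartanCoroot_apply (i j k : Fin n) :
    (cartanCoroot i j).1.1 k k = (if k = i then 1 else 0) - (if k = j then 1 else 0) := by
  change (coroot i j).1 k k = _
  rw [coroot_val, Matrix.sub_apply, Matrix.single_apply, Matrix.single_apply]
  simp [eq_comm]

theorem cartan_ext {g h : cartan n} (H : ∀ i, g.1.1 i i = h.1.1 i i) : g = h := by
  apply Subtype.ext
  apply Subtype.ext
  ext i j
  rcases eq_or_ne i j with rfl | hij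
  · exact H i
  · rw [g.2 hij, h.2 hij]

/-- The diagonal entries of an element of `𝔥`. -/
def diagEntry (i : Fin n) : cartan n →ₗ[ℂ] ℂ where
  toFun h := h.1.1 i i
  map_add' _ _ := rfl
  map_smul' _ _ := rfl

theorem diagEntry_apply (i : Fin n) (h : cartan n) : diagEntry i h = h.1.1 i i := rfl

theorem sum_diagEntry (h : cartan n) : ∑ i, h.1.1 i i = 0 := trace_coe h.1

/-- The functional `∑ i, a i ε_i` on `𝔥`. -/
def ofCoef (a : Fin n → ℂ) : Module.Dual ℂ (cartan n) := ∑ i, a i • diagEntry i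

theorem ofCoef_apply (a : Fin n → ℂ) (h : cartan n) : ofCoef a h = ∑ i, a i * h.1.1 i i := by
  simp [ofCoef, diagEntry_apply]

theorem ofCoef_cartanCoroot (a : Fin n → ℂ) (i j : Fin n) :
    ofCoef a (cartanCoroot i j) = a i - a j := by
  simp [ofCoef_apply, cartanCoroot_apply, mul_sub, Finset.sum_sub_distrib]

/-- The coefficients `a` of `ν = ∑ i, a i ε_i`, normalised by `∑ i, a i = 0`. -/
noncomputable def coef (ν : Module.Dual ℂ (cartan n)) (i : Fin n) : ℂ :=
  (n : ℂ)⁻¹ * ∑ j, ν (cartanCoroot i j)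

/-- The linear form `∑ i, a i X_i`, with `a` the normalised coefficients of `ν`, evaluated at
`θ`. -/
noncomputable def linForm {R : Type*} [CommRing R] [Algebra ℂ R] (ν : Module.Dual ℂ (cartan n))
    (θ : Fin n → R) : R := ∑ i, coef ν i • θ i

theorem cartanCoroot_swap (i j : Fin n) : cartanCoroot j i = -cartanCoroot i j := by
  apply cartan_ext
  intro k
  change _ = -(cartanCoroot i j).1.1 k k
  rw [cartanCoroot_apply, cartanCoroot_apply]
  ring

theorem sum_coef (ν : Module.Dual ℂ (cartan n)) : ∑ i, coef ν i = 0 := by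
  simp only [coef, ← Finset.mul_sum]
  have h1 : ∑ i, ∑ j, ν (cartanCoroot i j) = -∑ i, ∑ j, ν (cartanCoroot i j) := by
    conv_lhs => rw [Finset.sum_comm]
    rw [← Finset.sum_neg_distrib]
    refine Finset.sum_congr rfl fun i _ => ?_
    rw [← Finset.sum_neg_distrib]
    refine Finset.sum_congr rfl fun j _ => ?_
    rw [cartanCoroot_swap, map_neg]
  rw [self_eq_neg.1 h1, mul_zero]

/-- The telescoping sum behind `∑_i (θ_1 + ⋯ + θ_i) H_i = diag (θ_1, …, θ_n)`. The last diagonal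
entry uses `∑ j, θ j = 0`. -/
theorem coroot_sum_apply {R : Type*} [CommRing R] {θ : Fin n → R} (hθ : ∑ i, θ i = 0) (k : Fin n) :
    ∑ i : Fin (n - 1), (∑ j : Fin n with j.1 ≤ i.1, θ j) *
      ((if k.1 = i.1 then 1 else 0) - (if k.1 = i.1 + 1 then 1 else 0)) = θ k := by
  set s : ℕ → R := fun i => ∑ j : Fin n with j.1 ≤ i, θ j with hs
  rw [Fin.sum_univ_eq_sum_range
    (fun i => s i * ((if k.1 = i then 1 else 0) - (if k.1 = i + 1 then 1 else 0))) (n - 1)]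
  simp only [mul_sub, Finset.sum_sub_distrib, mul_ite, mul_one, mul_zero]
  have h1 : ∑ i ∈ Finset.range (n - 1), (if k.1 = i then s i else 0) = s k.1 := by
    rw [Finset.sum_ite_eq]
    split_ifs with h
    · rfl
    · simp only [Finset.mem_range] at h
      simp only [hs]
      rw [Finset.filter_true_of_mem (fun j _ => by omega), hθ]
  rw [h1]
  obtain ⟨k, hk⟩ := k
  obtain _ | k := k
  · have h2 : ({j : Fin n | j.1 ≤ 0} : Finset (Fin n)) = {⟨0, hk⟩} := by
      ext j
      simp [Fin.ext_iff]
    simp only [hs]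
    rw [h2]
    simp
  · have h2 : ({j : Fin n | j.1 ≤ k + 1} : Finset (Fin n)) =
        insert ⟨k + 1, hk⟩ ({j : Fin n | j.1 ≤ k} : Finset (Fin n)) := by
      ext j
      simp only [Finset.mem_filter, Finset.mem_univ, true_and, Finset.mem_insert, Fin.ext_iff]
      omega
    have h3 : ∑ i ∈ Finset.range (n - 1), (if k + 1 = i + 1 then s i else 0) = s k := by
      simp only [Nat.add_right_cancel_iff]
      rw [Finset.sum_ite_eq, if_pos (Finset.mem_range.2 (by omega))]
    rw [h3]
    simp only [hs]
    rw [h2, Finset.sum_insert (by simp)]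
    ring

theorem diagElement_apply {θ : Fin n → ℂ} (hθ : ∑ i, θ i = 0) (k : Fin n) :
    (diagElement θ).1.1 k k = θ k := by
  rw [← diagEntry_apply, diagElement]
  simp only [map_sum, map_smul, diagEntry_apply, cartanSimpleCoroot, cartanCoroot_apply,
    smul_eq_mul, Fin.ext_iff]
  exact coroot_sum_apply hθ k

variable [NeZero n]

theorem card_ne_zero : (n : ℂ) ≠ 0 := Nat.cast_ne_zero.2 (NeZero.ne n)

theorem cartan_eq_sum_coroot (h : cartan n) :
    h = (n : ℂ)⁻¹ • ∑ i, ∑ j, h.1.1 i i • cartanCoroot i j := by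
  apply cartan_ext
  intro k
  rw [← diagEntry_apply, ← diagEntry_apply]
  simp only [map_smul, map_sum, diagEntry_apply, cartanCoroot_apply, smul_eq_mul, mul_sub,
    Finset.sum_sub_distrib, mul_ite, mul_one, mul_zero, Finset.sum_ite_eq, Finset.mem_univ,
    if_true, sum_diagEntry, Finset.sum_const, Finset.card_univ, Fintype.card_fin]
  simp only [nsmul_eq_mul, mul_ite, mul_zero, Finset.sum_ite_eq, Finset.mem_univ, if_true,
    sub_zero]
  rw [inv_mul_cancel_left₀ card_ne_zero]

theorem ofCoef_coef (ν : Module.Dual ℂ (cartan n)) : ofCoef (coef ν) = ν := by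
  ext h
  conv_rhs => rw [cartan_eq_sum_coroot h]
  simp only [map_smul, map_sum, ofCoef_apply, coef, smul_eq_mul, Finset.mul_sum, Finset.sum_mul]
  refine Finset.sum_congr rfl fun i _ => Finset.sum_congr rfl fun j _ => ?_
  ring

theorem coef_ofCoef {a : Fin n → ℂ} (ha : ∑ i, a i = 0) : coef (ofCoef a) = a := by
  ext i
  rw [coef]
  simp only [ofCoef_cartanCoroot, Finset.sum_sub_distrib, ha, Finset.sum_const, Finset.card_univ,
    Fintype.card_fin]
  rw [sub_zero, nsmul_eq_mul, inv_mul_cancel_left₀ card_ne_zero]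

theorem coef_injective : Function.Injective (coef (n := n)) :=
  Function.LeftInverse.injective ofCoef_coef

theorem coef_sub_coef (ν : Module.Dual ℂ (cartan n)) (i j : Fin n) :
    coef ν i - coef ν j = ν (cartanCoroot i j) := by
  conv_rhs => rw [← ofCoef_coef ν, ofCoef_cartanCoroot]

theorem apply_eq_linForm (ν : Module.Dual ℂ (cartan n)) (h : cartan n) :
    ν h = linForm ν (fun i => h.1.1 i i) := by
  conv_lhs => rw [← ofCoef_coef ν, ofCoef_apply]
  rfl

theorem apply_diagElement (ν : Module.Dual ℂ (cartan n)) {θ : Fin n → ℂ} (hθ : ∑ i, θ i = 0) :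
    ν (diagElement θ) = linForm ν θ := by
  rw [apply_eq_linForm]
  simp only [diagElement_apply hθ]

theorem coef_rootReflection {i j : Fin n} (hij : i ≠ j) (ν : Module.Dual ℂ (cartan n)) :
    coef (rootReflection hij ν) = coef ν ∘ Equiv.swap i j := by
  have hsum : ∑ k, (coef ν ∘ Equiv.swap i j) k = 0 := by
    rw [← sum_coef ν]
    exact Equiv.sum_comp (Equiv.swap i j) (coef ν)
  rw [← coef_ofCoef hsum]
  congr 1
  ext h
  have h1 : rootReflection hij ν = ν - ν (cartanCoroot i j) • root i j :=
    Module.reflection_apply _ _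
  have h2 : root i j h = h.1.1 i i - h.1.1 j j := rfl
  rw [h1, LinearMap.sub_apply, LinearMap.smul_apply, h2, ← coef_sub_coef, apply_eq_linForm,
    linForm, ofCoef_apply, smul_eq_mul, sub_eq_iff_eq_add', ← sub_eq_iff_eq_add,
    ← Finset.sum_sub_distrib, Finset.sum_eq_add_of_mem i j (Finset.mem_univ _) (Finset.mem_univ _)
    hij]
  · simp
    ring
  · rintro k - ⟨hki, hkj⟩
    simp [Equiv.swap_apply_of_ne_of_ne hki hkj]

/-- The Weyl group acts by permuting the normalised coefficients. -/
theorem mem_weylOrbit_iff {μ ν : Module.Dual ℂ (cartan n)} :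
    ν ∈ weylOrbit μ ↔ ∃ σ : Equiv.Perm (Fin n), coef ν = coef μ ∘ σ := by
  constructor
  · rintro ⟨⟨g, hg⟩, rfl⟩
    suffices h : ∃ σ : Equiv.Perm (Fin n), ∀ ν, coef (g ν) = coef ν ∘ σ by
      obtain ⟨σ, hσ⟩ := h
      exact ⟨σ, hσ μ⟩
    induction hg using Subgroup.closure_induction with
    | mem x hx =>
      obtain ⟨i, j, hij, rfl⟩ := hx
      exact ⟨Equiv.swap i j, coef_rootReflection hij⟩
    | one => exact ⟨1, fun ν => rfl⟩
    | mul x y hx hy ihx ihy =>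
      obtain ⟨σ, hσ⟩ := ihx
      obtain ⟨τ, hτ⟩ := ihy
      refine ⟨τ * σ, fun ν => ?_⟩
      rw [LinearEquiv.mul_apply, hσ, hτ]
      rfl
    | inv x hx ih =>
      obtain ⟨σ, hσ⟩ := ih
      refine ⟨σ⁻¹, fun ν => ?_⟩
      have h1 := hσ (x⁻¹ ν)
      rw [← LinearEquiv.mul_apply, mul_inv_cancel] at h1
      change coef ν = _ at h1
      rw [h1]
      ext i
      simp
  · rintro ⟨σ, hσ⟩
    induction σ using Equiv.Perm.swap_induction_on' generalizing ν with
    | one =>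
      rw [coef_injective hσ]
      exact MulAction.mem_orbit_self μ
    | mul_swap σ i j hij ih =>
      have h1 : coef (rootReflection hij ν) = coef μ ∘ σ := by
        rw [coef_rootReflection, hσ]
        ext k
        simp
      have h2 := ih h1
      have h3 : rootReflection hij ∈ weylGroup n := Subgroup.subset_closure ⟨i, j, hij, rfl⟩
      have h4 : ν = (⟨rootReflection hij, h3⟩ : weylGroup n) • rootReflection hij ν :=
        (Module.involutive_reflection (root_cartanCoroot hij) ν).symm
      rw [h4]
      exact (MulAction.mem_orbit_of_mem_orbit _ h2)

theorem weylOrbit_finite (μ : Module.Dual ℂ (cartan n)) : (weylOrbit μ).Finite := by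
  refine (Set.finite_range fun σ : Equiv.Perm (Fin n) => ofCoef (coef μ ∘ σ)).subset ?_
  intro ν hν
  obtain ⟨σ, hσ⟩ := mem_weylOrbit_iff.1 hν
  exact ⟨σ, by simp only [← hσ, ofCoef_coef]⟩

/-- The functional obtained from `ν` by permuting its coefficients. -/
noncomputable def permute (σ : Equiv.Perm (Fin n)) (ν : Module.Dual ℂ (cartan n)) :
    Module.Dual ℂ (cartan n) := ofCoef (coef ν ∘ σ)

theorem coef_permute (σ : Equiv.Perm (Fin n)) (ν : Module.Dual ℂ (cartan n)) :
    coef (permute σ ν) = coef ν ∘ σ :=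
  coef_ofCoef ((Equiv.sum_comp σ (coef ν)).trans (sum_coef ν))

theorem permute_mem_weylOrbit {μ ν : Module.Dual ℂ (cartan n)} (hν : ν ∈ weylOrbit μ)
    (σ : Equiv.Perm (Fin n)) : permute σ ν ∈ weylOrbit μ := by
  obtain ⟨τ, hτ⟩ := mem_weylOrbit_iff.1 hν
  exact mem_weylOrbit_iff.2 ⟨τ * σ, by rw [coef_permute, hτ]; rfl⟩

theorem exists_permute_eq {μ ν ν' : Module.Dual ℂ (cartan n)} (hν : ν ∈ weylOrbit μ)
    (hν' : ν' ∈ weylOrbit μ) : ∃ σ, ν' = permute σ ν := by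
  obtain ⟨τ, hτ⟩ := mem_weylOrbit_iff.1 hν
  obtain ⟨τ', hτ'⟩ := mem_weylOrbit_iff.1 hν'
  refine ⟨τ⁻¹ * τ', coef_injective ?_⟩
  rw [coef_permute, hτ, hτ']
  ext i
  simp

theorem linForm_permute {R : Type*} [CommRing R] [Algebra ℂ R] (σ : Equiv.Perm (Fin n))
    (ν : Module.Dual ℂ (cartan n)) (θ : Fin n → R) :
    linForm (permute σ ν) θ = linForm ν (θ ∘ σ.symm) := by
  rw [linForm, linForm, coef_permute]
  rw [← Equiv.sum_comp σ (fun i => coef ν i • (θ ∘ σ.symm) i)]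
  simp

open scoped ComplexOrder in
theorem antitone_coef {μ : Module.Dual ℂ (cartan n)}
    (hμ : ∀ i : Fin (n - 1), ∃ k : ℕ, μ (cartanSimpleCoroot i) = k) : Antitone (coef μ) := by
  obtain _ | m := n
  · exact fun i => i.elim0
  rw [Fin.antitone_iff_succ_le]
  intro i
  obtain ⟨k, hk⟩ := hμ i
  have h1 : coef μ i.castSucc - coef μ i.succ = k := by
    rw [coef_sub_coef, ← hk]
    rfl
  rw [← sub_nonneg, h1]
  exact Nat.cast_nonneg k

open scoped ComplexOrder in
/-- Dominant weights have weakly decreasing coefficients, so an orbit contains at most one. -/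
theorem eq_of_dominant {μ ν : Module.Dual ℂ (cartan n)}
    (hμ : ∀ i : Fin (n - 1), ∃ k : ℕ, μ (cartanSimpleCoroot i) = k)
    (hν : ∀ i : Fin (n - 1), ∃ k : ℕ, ν (cartanSimpleCoroot i) = k)
    (h : ν ∈ weylOrbit μ) : ν = μ := by
  obtain ⟨σ, hσ⟩ := mem_weylOrbit_iff.1 h
  apply coef_injective
  have h1 := antitone_coef hμ
  have h2 := antitone_coef hν
  have h3 := Tuple.unique_monotone (f := OrderDual.toDual ∘ coef μ) (σ := σ) (τ := 1)
    (by rw [hσ] at h2; exact fun i j hij => h2 hij) (fun i j hij => h1 hij)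
  rw [hσ]
  exact h3

/-- Sorting the coefficients, whose differences are integers, makes a weight dominant. -/
theorem exists_dominant {ν : Module.Dual ℂ (cartan n)}
    (hν : ∀ i j, i ≠ j → ∃ k : ℤ, ν (cartanCoroot i j) = k) :
    ∃ μ : Module.Dual ℂ (cartan n),
      (∀ i : Fin (n - 1), ∃ k : ℕ, μ (cartanSimpleCoroot i) = k) ∧ ν ∈ weylOrbit μ := by
  have h0 (i : Fin n) : ∃ k : ℤ, coef ν 0 - coef ν i = k := by
    rcases eq_or_ne 0 i with rfl | h
    · exact ⟨0, by simp⟩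
    · rw [coef_sub_coef]
      exact hν 0 i h
  choose b hb using h0
  refine ⟨permute (Tuple.sort b) ν, fun i => ?_, ?_⟩
  · rw [cartanSimpleCoroot, ← coef_sub_coef, coef_permute]
    set i₀ : Fin n := ⟨i.1, by omega⟩
    set i₁ : Fin n := ⟨i.1 + 1, by omega⟩
    have hle : i₀ ≤ i₁ := by simp [i₀, i₁]
    have h1 := Tuple.monotone_sort b hle
    obtain ⟨k, hk⟩ := Int.eq_ofNat_of_zero_le (sub_nonneg.2 h1)
    refine ⟨k, ?_⟩
    have h2 : (coef ν ∘ Tuple.sort b) i₀ - (coef ν ∘ Tuple.sort b) i₁ =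
        ((b (Tuple.sort b i₁) - b (Tuple.sort b i₀) : ℤ) : ℂ) := by
      rw [Int.cast_sub, ← hb, ← hb]
      simp
    rw [h2]
    simp only [Function.comp_apply] at hk
    rw [hk, Int.cast_natCast]
  · refine mem_weylOrbit_iff.2 ⟨(Tuple.sort b)⁻¹, ?_⟩
    rw [coef_permute]
    ext i
    simp

end Weights

end SlCharPoly

/-! ### The weight decomposition and its symmetry -/

namespace SlCharPoly

open LieAlgebra.SpecialLinear

section Decomposition

variable {n : ℕ}

theorem coroot_self (i : Fin n) : coroot i i = 0 := by
  apply Subtype.ext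
  rw [coroot_val, sub_self]
  rfl

theorem cartan_val_eq_diagonal (h : cartan n) : h.1.1 = Matrix.diagonal fun i => h.1.1 i i :=
  ((Matrix.isDiag_iff_diagonal_diag h.1.1).1 h.2).symm

variable {V : Type*} [AddCommGroup V] [Module ℂ V] (φ : sl (Fin n) ℂ →ₗ⁅ℂ⁆ Module.End ℂ V)

theorem commute_map_cartan (g h : cartan n) : Commute (φ g.1) (φ h.1) := by
  have h1 : g.1.1 * h.1.1 - h.1.1 * g.1.1 = (0 : sl (Fin n) ℂ).1 := by
    rw [cartan_val_eq_diagonal g, cartan_val_eq_diagonal h, Matrix.diagonal_mul_diagonal,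
      Matrix.diagonal_mul_diagonal]
    simp only [mul_comm, sub_self]
    rfl
  have h2 := map_lie_eq φ h1
  rw [map_zero, sub_eq_zero] at h2
  exact h2

theorem mem_weightSpace {ν : Module.Dual ℂ (cartan n)} {v : V} :
    v ∈ weightSpace φ ν ↔ ∀ h : cartan n, φ h.1 v = ν h • v := by
  simp [weightSpace, Submodule.mem_iInf]

theorem mapsTo_maxGenEigenspace_coroot (p q : Fin n × Fin n) (c : ℂ) :
    Set.MapsTo (φ (coroot p.1 p.2)) ((φ (coroot q.1 q.2)).maxGenEigenspace c)
      ((φ (coroot q.1 q.2)).maxGenEigenspace c) :=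
  Module.End.mapsTo_maxGenEigenspace_of_comm
    (commute_map_cartan φ (cartanCoroot q.1 q.2) (cartanCoroot p.1 p.2)) c

theorem isSemisimple_map_coroot [FiniteDimensional ℂ V] (i j : Fin n) :
    (φ (coroot i j)).IsSemisimple := by
  rcases eq_or_ne i j with rfl | hij
  · rw [coroot_self, map_zero]
    exact Module.End.isSemisimple_zero
  · obtain ⟨h1, h2, h3⟩ := map_sl_two φ hij
    exact isSemisimple_of_sl_two h1 h2 h3

theorem maxGenEigenspace_map_coroot [FiniteDimensional ℂ V] (p : Fin n × Fin n) (c : ℂ) :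
    (φ (coroot p.1 p.2)).maxGenEigenspace c = (φ (coroot p.1 p.2)).eigenspace c :=
  (isSemisimple_map_coroot φ p.1 p.2).isFinitelySemisimple.maxGenEigenspace_eq_eigenspace c

theorem weight_integral [FiniteDimensional ℂ V] {ν : Module.Dual ℂ (cartan n)}
    (hν : weightSpace φ ν ≠ ⊥) {i j : Fin n} (hij : i ≠ j) : ∃ k : ℤ, ν (cartanCoroot i j) = k := by
  obtain ⟨v, hv, hv0⟩ := (Submodule.ne_bot_iff _).1 hν
  obtain ⟨h1, h2, h3⟩ := map_sl_two φ hij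
  refine exists_intCast_of_sl_two h1 h2 h3 (Module.End.hasEigenvalue_of_hasEigenvector (x := v) ?_)
  exact ⟨Module.End.mem_eigenspace_iff.2 ((mem_weightSpace φ).1 hv (cartanCoroot i j)), hv0⟩

variable [NeZero n]

/-- A common eigenvector of the coroots is a weight vector. -/
theorem exists_weight_of_coroot {χ : Fin n × Fin n → ℂ} {v : V} (hv0 : v ≠ 0)
    (hv : ∀ i j, φ (coroot i j) v = χ (i, j) • v) :
    ∃ ν : Module.Dual ℂ (cartan n), (∀ h : cartan n, φ h.1 v = ν h • v) ∧
      ∀ i j, ν (cartanCoroot i j) = χ (i, j) := by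
  let ν : Module.Dual ℂ (cartan n) := (n : ℂ)⁻¹ • ∑ i, ∑ j, χ (i, j) • diagEntry i
  have h1 (h : cartan n) : φ h.1 v = ν h • v := by
    let ψ : cartan n →ₗ[ℂ] V := (LinearMap.applyₗ v) ∘ₗ (φ : sl (Fin n) ℂ →ₗ[ℂ] Module.End ℂ V) ∘ₗ
      (cartan n).toSubmodule.subtype
    have h2 : φ h.1 v = ψ h := rfl
    have h3 (i j : Fin n) : ψ (cartanCoroot i j) = χ (i, j) • v := hv i j
    have h4 : ψ h = (n : ℂ)⁻¹ • ∑ i, ∑ j, h.1.1 i i • χ (i, j) • v := by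
      conv_lhs => rw [cartan_eq_sum_coroot h]
      simp only [map_smul, map_sum, h3]
    rw [h2, h4]
    simp only [ν, LinearMap.smul_apply, LinearMap.sum_apply, diagEntry_apply, smul_eq_mul,
      mul_smul, Finset.sum_smul, Finset.smul_sum]
    refine Finset.sum_congr rfl fun i _ => Finset.sum_congr rfl fun j _ => ?_
    rw [smul_comm (h.1.1 i i)]
  refine ⟨ν, h1, fun i j => ?_⟩
  have h4 := (h1 (cartanCoroot i j)).symm.trans (hv i j)
  exact smul_left_injective ℂ hv0 h4

theorem weightSpace_eq_iInf_coroot (ν : Module.Dual ℂ (cartan n)) :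
    weightSpace φ ν = ⨅ p : Fin n × Fin n,
      Module.End.eigenspace (φ (coroot p.1 p.2)) (ν (cartanCoroot p.1 p.2)) := by
  ext v
  rw [mem_weightSpace, Submodule.mem_iInf]
  simp only [Module.End.mem_eigenspace_iff]
  constructor
  · exact fun h p => h (cartanCoroot p.1 p.2)
  · intro h
    rcases eq_or_ne v 0 with rfl | hv
    · simp
    · obtain ⟨ν', h1, h2⟩ := exists_weight_of_coroot φ
        (χ := fun p => ν (cartanCoroot p.1 p.2)) hv (fun i j => h (i, j))
      have h3 : ν' = ν := by
        apply coef_injective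
        ext i
        simp only [coef, h2]
      rwa [← h3]

variable [FiniteDimensional ℂ V]

/-- The coroots act by commuting semisimple endomorphisms, so `V` is the sum of its
weight spaces. -/
theorem iSup_weightSpace : ⨆ ν, weightSpace φ ν = ⊤ := by
  rw [eq_top_iff, ← Module.End.iSup_iInf_maxGenEigenspace_eq_top_of_forall_mapsTo
    (fun p : Fin n × Fin n => φ (coroot p.1 p.2)) (mapsTo_maxGenEigenspace_coroot φ)
    (fun p => Module.End.iSup_maxGenEigenspace_eq_top _)]
  refine iSup_le fun χ => ?_
  simp only [maxGenEigenspace_map_coroot]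
  intro v hv
  rcases eq_or_ne v 0 with rfl | hv0
  · exact zero_mem _
  · simp only [Submodule.mem_iInf, Module.End.mem_eigenspace_iff] at hv
    obtain ⟨ν, hν, -⟩ := exists_weight_of_coroot φ hv0 (fun i j => hv (i, j))
    exact Submodule.mem_iSup_of_mem ν ((mem_weightSpace φ).2 hν)

theorem iSupIndep_weightSpace : iSupIndep (weightSpace φ) := by
  have h1 := Module.End.independent_iInf_maxGenEigenspace_of_forall_mapsTo
    (fun p : Fin n × Fin n => φ (coroot p.1 p.2)) (mapsTo_maxGenEigenspace_coroot φ)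
  simp only [maxGenEigenspace_map_coroot] at h1
  have h2 : Function.Injective fun (ν : Module.Dual ℂ (cartan n)) (p : Fin n × Fin n) =>
      ν (cartanCoroot p.1 p.2) := by
    intro ν ν' h
    apply coef_injective
    ext i
    simp only [coef]
    congr 1
    exact Finset.sum_congr rfl fun j _ => congrFun h (i, j)
  have h3 := h1.comp h2
  have h4 : weightSpace φ = fun ν => ⨅ p : Fin n × Fin n,
      Module.End.eigenspace (φ (coroot p.1 p.2)) (ν (cartanCoroot p.1 p.2)) :=
    funext (weightSpace_eq_iInf_coroot φ)
  rw [h4]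
  exact h3

theorem finite_weights : {ν | weightSpace φ ν ≠ ⊥}.Finite :=
  WellFoundedGT.finite_ne_bot_of_iSupIndep (iSupIndep_weightSpace φ)

/-- On the Cartan subalgebra, the characteristic polynomial splits according to the weights. -/
theorem det_map_cartan (c : ℂ) (h : cartan n) :
    LinearMap.det (c • (LinearMap.id : V →ₗ[ℂ] V) + φ h.1) =
      ∏ ν ∈ (finite_weights φ).toFinset, (c + ν h) ^ weightMult φ ν := by
  classical
  have hint : DirectSum.IsInternal fun ν : {ν // weightSpace φ ν ≠ ⊥} => weightSpace φ ν.1 :=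
    DirectSum.isInternal_ne_bot_iff.2
      (DirectSum.isInternal_submodule_of_iSupIndep_of_iSup_eq_top (iSupIndep_weightSpace φ)
        (iSup_weightSpace φ))
  have : Fintype {ν // weightSpace φ ν ≠ ⊥} := (finite_weights φ).fintype
  let b := hint.collectedBasis fun ν => Module.finBasis ℂ (weightSpace φ ν.1)
  have hb (x : Σ ν : {ν // weightSpace φ ν ≠ ⊥}, Fin (Module.finrank ℂ (weightSpace φ ν.1))) :
      (c • (LinearMap.id : V →ₗ[ℂ] V) + φ h.1) (b x) = (c + x.1.1 h) • b x := by
    have h1 : b x ∈ weightSpace φ x.1.1 := hint.collectedBasis_mem _ x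
    rw [LinearMap.add_apply, (mem_weightSpace φ).1 h1 h, add_smul]
    rfl
  have hM : LinearMap.toMatrix b b (c • (LinearMap.id : V →ₗ[ℂ] V) + φ h.1) =
      Matrix.diagonal fun x => c + x.1.1 h := by
    ext x y
    rw [LinearMap.toMatrix_apply, hb, map_smul, Finsupp.smul_apply, Module.Basis.repr_self,
      Finsupp.single_apply, Matrix.diagonal_apply]
    rcases eq_or_ne x y with rfl | hxy
    · simp
    · simp [hxy, hxy.symm]
  rw [← LinearMap.det_toMatrix b, hM, Matrix.det_diagonal, Fintype.prod_sigma]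
  simp only [Finset.prod_const, Finset.card_univ, Fintype.card_fin]
  exact (Finset.prod_subtype (finite_weights φ).toFinset (by simp)
    (fun ν => (c + ν h) ^ weightMult φ ν)).symm

end Decomposition

section Conjugation

variable {n : ℕ} {V : Type*} [AddCommGroup V] [Module ℂ V] [FiniteDimensional ℂ V]
  (φ : sl (Fin n) ℂ →ₗ⁅ℂ⁆ Module.End ℂ V)

/-- The diagonalising columns of `M` may be rescaled, so the diagonal factor of `M` can be
dropped. -/
theorem exists_liftable_diagonalizing (M : Matrix (Fin n) (Fin n) ℂ) (hM : M.det ≠ 0) :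
    ∃ T : (Matrix (Fin n) (Fin n) ℂ)ˣ, Liftable φ T ∧ ∀ A b,
      A * M = M * Matrix.diagonal b → A * T.1 = T.1 * Matrix.diagonal b := by
  obtain ⟨T, hT, d, rfl⟩ := exists_liftable_mul_diagonal φ M hM
  refine ⟨T, hT, fun A b h => ?_⟩
  rw [Matrix.det_mul] at hM
  have hd : IsUnit (Matrix.diagonal d) := (Matrix.isUnit_iff_isUnit_det _).2
    (isUnit_iff_ne_zero.2 (right_ne_zero_of_mul hM))
  have hc : Matrix.diagonal d * Matrix.diagonal b = Matrix.diagonal b * Matrix.diagonal d := by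
    simp only [Matrix.diagonal_mul_diagonal, mul_comm]
  rw [mul_assoc, hc, ← mul_assoc, ← mul_assoc] at h
  exact hd.mul_right_cancel h

theorem sum_eq_zero_of_charpoly {A : Matrix (Fin n) (Fin n) ℂ} (hA : A.trace = 0) {θ : Fin n → ℂ}
    (h : A.charpoly = ∏ i, (Polynomial.X - Polynomial.C (θ i))) : ∑ i, θ i = 0 := by
  obtain _ | n := n
  · simp
  rw [← Matrix.charpoly_diagonal] at h
  rw [← Matrix.trace_diagonal, Matrix.trace_eq_neg_charpoly_coeff, ← h,
    ← Matrix.trace_eq_neg_charpoly_coeff, hA]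

theorem exists_mul_eq_mul_diagonal {A : Matrix (Fin n) (Fin n) ℂ} {θ : Fin n → ℂ}
    (hθ : Function.Injective θ) (h : A.charpoly = ∏ i, (Polynomial.X - Polynomial.C (θ i))) :
    ∃ M : Matrix (Fin n) (Fin n) ℂ, M.det ≠ 0 ∧ A * M = M * Matrix.diagonal θ := by
  have h1 (i : Fin n) : ∃ v, v ≠ 0 ∧ A.mulVec v = θ i • v := by
    have h2 : (Matrix.scalar (Fin n) (θ i) - A).det = 0 := by
      rw [← Matrix.eval_charpoly, h, Polynomial.eval_prod]
      exact Finset.prod_eq_zero (Finset.mem_univ i) (by simp)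
    obtain ⟨v, hv, hv'⟩ := Matrix.exists_mulVec_eq_zero_iff.2 h2
    refine ⟨v, hv, ?_⟩
    rw [Matrix.sub_mulVec, sub_eq_zero] at hv'
    rw [← hv']
    ext j
    simp [Matrix.scalar_apply, Matrix.mulVec_diagonal]
  choose v hv0 hv using h1
  have hli : LinearIndependent ℂ v := Module.End.eigenvectors_linearIndependent' (Matrix.toLin' A)
    θ hθ v fun i => ⟨Module.End.mem_eigenspace_iff.2 (by rw [Matrix.toLin'_apply, hv]), hv0 i⟩
  refine ⟨(Matrix.of v).transpose, ?_, ?_⟩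
  · rw [Matrix.det_transpose]
    exact ((Matrix.isUnit_iff_isUnit_det _).1
      (Matrix.linearIndependent_rows_iff_isUnit.1 hli)).ne_zero
  · ext i j
    rw [Matrix.mul_diagonal]
    have := congrFun (hv j) i
    rw [Pi.smul_apply, smul_eq_mul, mul_comm] at this
    rw [Matrix.transpose_apply, Matrix.of_apply, ← this]
    rfl

theorem diagElement_val {θ : Fin n → ℂ} (hθ : ∑ i, θ i = 0) :
    (diagElement θ).1.1 = Matrix.diagonal θ := by
  rw [cartan_val_eq_diagonal]
  simp only [diagElement_apply hθ]

theorem weightMult_ne_zero_iff {ν : Module.Dual ℂ (cartan n)} :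
    weightMult φ ν ≠ 0 ↔ weightSpace φ ν ≠ ⊥ := by
  rw [weightMult, Ne, Submodule.finrank_eq_zero]

variable [NeZero n]

/-- An element with distinct eigenvalues is conjugate to a diagonal one by a liftable matrix, so the
formula on the Cartan subalgebra carries over to it. -/
theorem det_map_of_charpoly (c : ℂ) (L : sl (Fin n) ℂ) {θ : Fin n → ℂ}
    (hθ : Function.Injective θ) (h : L.1.charpoly = ∏ i, (Polynomial.X - Polynomial.C (θ i))) :
    LinearMap.det (c • (LinearMap.id : V →ₗ[ℂ] V) + φ L) =
      ∏ ν ∈ (finite_weights φ).toFinset, (c + linForm ν θ) ^ weightMult φ ν := by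
  have hsum := sum_eq_zero_of_charpoly (trace_coe L) h
  obtain ⟨M, hM, hLM⟩ := exists_mul_eq_mul_diagonal hθ h
  obtain ⟨T, ⟨g, hg⟩, hTd⟩ := exists_liftable_diagonalizing φ M hM
  have h1 := hTd _ _ hLM
  rw [← diagElement_val hsum] at h1
  have h2 := hg _ _ h1
  have h3 : (c • (LinearMap.id : V →ₗ[ℂ] V) + φ L) * g.1 =
      g.1 * (c • (LinearMap.id : V →ₗ[ℂ] V) + φ (diagElement θ).1) := by
    rw [add_mul, mul_add, h2]
    congr 1
    ext v
    simp
  have h4 := congrArg LinearMap.det h3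
  rw [map_mul, map_mul, mul_comm] at h4
  have h5 : LinearMap.det g.1 ≠ 0 := (g.isUnit.map LinearMap.det).ne_zero
  rw [mul_left_cancel₀ h5 h4, det_map_cartan]
  simp only [apply_diagElement _ hsum]

/-- A permutation matrix is, up to a diagonal factor, liftable; the lift carries a weight space into
the permuted one. -/
theorem weightMult_le_permute (σ : Equiv.Perm (Fin n)) (ν : Module.Dual ℂ (cartan n)) :
    weightMult φ ν ≤ weightMult φ (permute σ ν) := by
  obtain ⟨T, ⟨g, hg⟩, hT⟩ := exists_liftable_diagonalizing φ (σ.permMatrix ℂ)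
    (by rw [Matrix.det_permutation]; simp)
  let e : V ≃ₗ[ℂ] V := LinearMap.GeneralLinearGroup.generalLinearEquiv ℂ V g
  have he (v : V) : e v = g.1 v := rfl
  have hle : (weightSpace φ ν).map (e : V →ₗ[ℂ] V) ≤ weightSpace φ (permute σ ν) := by
    rintro - ⟨v, hv, rfl⟩
    rw [mem_weightSpace]
    intro h
    -- `b` is the diagonal of `h`, permuted so that `σ` conjugates `diag b` to `h`.
    set b : Fin n → ℂ := fun i => h.1.1 (σ.symm i) (σ.symm i) with hb
    have hsum : ∑ i, b i = 0 := by
      rw [hb, Equiv.sum_comp σ.symm (fun i => h.1.1 i i), sum_diagEntry]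
    have h1 : h.1.1 * σ.permMatrix ℂ = σ.permMatrix ℂ * Matrix.diagonal b := by
      rw [cartan_val_eq_diagonal h]
      ext i j
      rw [Matrix.diagonal_mul, Matrix.mul_diagonal]
      simp only [Equiv.Perm.permMatrix, PEquiv.toMatrix_apply, Equiv.toPEquiv_apply,
        Option.mem_some_iff, hb]
      split_ifs with hij
      · rw [← hij]; simp
      · simp
    have h2 := hT _ _ h1
    rw [← diagElement_val hsum] at h2
    have h3 := LinearMap.congr_fun (hg _ _ h2) v
    change φ h.1 (g.1 v) = g.1 (φ (diagElement b).1 v) at h3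
    change φ h.1 (g.1 v) = _ • g.1 v
    rw [h3, (mem_weightSpace φ).1 hv, map_smul, apply_diagElement _ hsum, apply_eq_linForm,
      linForm_permute]
    rfl
  rw [weightMult, weightMult, ← LinearEquiv.finrank_map_eq e]
  exact Submodule.finrank_mono hle

theorem weightMult_eq_of_mem_weylOrbit {μ ν : Module.Dual ℂ (cartan n)} (h : ν ∈ weylOrbit μ) :
    weightMult φ ν = weightMult φ μ := by
  have hμ : μ ∈ weylOrbit μ := MulAction.mem_orbit_self μ
  obtain ⟨σ, hσ⟩ := exists_permute_eq h hμ
  obtain ⟨τ, hτ⟩ := exists_permute_eq hμ h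
  apply le_antisymm
  · conv_rhs => rw [hσ]
    exact weightMult_le_permute φ σ ν
  · conv_rhs => rw [hτ]
    exact weightMult_le_permute φ τ μ

theorem finite_dominantWeights : (dominantWeights φ).Finite :=
  (finite_weights φ).subset fun _ h => h.1

/-- The weights, with their multiplicities, are grouped into the orbits of the dominant ones. -/
theorem prod_weights_eq (F : Module.Dual ℂ (cartan n) → ℂ) :
    ∏ ν ∈ (finite_weights φ).toFinset, F ν ^ weightMult φ ν =
      ∏ μ ∈ (finite_dominantWeights φ).toFinset,
        (∏ ν ∈ (weylOrbit_finite μ).toFinset, F ν) ^ weightMult φ μ := by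
  classical
  have h1 : (finite_weights φ).toFinset = (finite_dominantWeights φ).toFinset.biUnion
      fun μ => (weylOrbit_finite μ).toFinset := by
    ext ν
    simp only [Set.Finite.mem_toFinset, Set.mem_ofPred_eq, Finset.mem_biUnion]
    constructor
    · intro hν
      obtain ⟨μ, hμ, hνμ⟩ := exists_dominant fun i j hij => weight_integral φ hν hij
      refine ⟨μ, ⟨?_, hμ⟩, hνμ⟩
      rwa [← weightMult_ne_zero_iff, ← weightMult_eq_of_mem_weylOrbit φ hνμ,
        weightMult_ne_zero_iff]
    · rintro ⟨μ, ⟨hμ, -⟩, hνμ⟩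
      rwa [← weightMult_ne_zero_iff, weightMult_eq_of_mem_weylOrbit φ hνμ,
        weightMult_ne_zero_iff]
  rw [h1, Finset.prod_biUnion]
  · refine Finset.prod_congr rfl fun μ _ => ?_
    rw [← Finset.prod_pow]
    refine Finset.prod_congr rfl fun ν hν => ?_
    rw [weightMult_eq_of_mem_weylOrbit φ ((weylOrbit_finite μ).mem_toFinset.1 hν)]
  · intro μ hμ μ' hμ' hne
    simp only [Finset.mem_coe, Set.Finite.mem_toFinset] at hμ hμ'
    refine Finset.disjoint_left.2 fun ν hν hν' => hne ?_
    simp only [Set.Finite.mem_toFinset] at hν hν'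
    refine eq_of_dominant hμ'.2 hμ.2 ?_
    exact MulAction.orbit_eq_iff.1
      ((MulAction.orbit_eq_iff.2 hν).symm.trans (MulAction.orbit_eq_iff.2 hν'))

end Conjugation

end SlCharPoly

/-! ### Symmetric functions of the eigenvalues and orbital factors -/

namespace SlCharPoly

open LieAlgebra.SpecialLinear

section GenericMatrix

variable {n : ℕ} {R : Type*} [CommRing R] [Algebra ℂ R]

/-- The matrix `∑_b z_b b` with coordinates `z` in a commutative `ℂ`-algebra. -/
noncomputable def matrixAt (z : Var n → R) : Matrix (Fin n) (Fin n) R :=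
  ∑ b : ChevIndex n, z (some b) • (chevVec b).1.map (algebraMap ℂ R)

theorem matrixAt_eq_elementAt (z : Var n → ℂ) : matrixAt z = (elementAt z).1 := by
  have h1 : (elementAt z).1 = ∑ b : ChevIndex n, z (some b) • (chevVec b).1 := by
    change (sl (Fin n) ℂ).toSubmodule.subtype (elementAt z) = _
    rw [elementAt, map_sum]
    rfl
  rw [h1, matrixAt]
  rfl

theorem matrixAt_map {S : Type*} [CommRing S] [Algebra ℂ S] (f : R →ₐ[ℂ] S) (z : Var n → R) :
    (matrixAt z).map f = matrixAt fun b => f (z b) := by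
  ext i j
  simp [matrixAt, Matrix.sum_apply]

/-- The coordinates of a trace-free matrix in the Chevalley basis. -/
def coords (A : Matrix (Fin n) (Fin n) R) : ChevIndex n → R
  | Sum.inl i => ∑ j : Fin n with j.1 ≤ i.1, A j j
  | Sum.inr p => A p.1.1 p.1.2

theorem matrixAt_of_coords {A : Matrix (Fin n) (Fin n) R} (hA : A.trace = 0) {z : Var n → R}
    (hz : ∀ b, z (some b) = coords A b) : matrixAt z = A := by
  ext k l
  simp only [matrixAt, Matrix.sum_apply, Matrix.smul_apply, Matrix.map_apply, smul_eq_mul, hz,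
    Fintype.sum_sum_type]
  have h1 (i : Fin (n - 1)) : (chevVec (Sum.inl i)).1 k l =
      if k = l then (if k.1 = i.1 then 1 else 0) - (if k.1 = i.1 + 1 then 1 else 0) else 0 := by
    change (coroot _ _).1 k l = _
    rw [coroot_val, Matrix.sub_apply, Matrix.single_apply, Matrix.single_apply]
    simp only [Fin.ext_iff]
    split_ifs <;> first | omega | simp
  have h2 (p : {p : Fin n × Fin n // p.1 ≠ p.2}) : (chevVec (Sum.inr p)).1 k l =
      if p.1 = (k, l) then 1 else 0 := by
    change (single _ _ _ _).1 k l = _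
    rw [val_single, Matrix.single_apply]
    simp [Prod.ext_iff]
  simp only [h1, h2, coords]
  rcases eq_or_ne k l with rfl | hkl
  · have h3 (p : {p : Fin n × Fin n // p.1 ≠ p.2}) : p.1 ≠ (k, k) := fun h => p.2 (by rw [h])
    simp only [h3, if_true, if_false, map_zero, mul_zero, Finset.sum_const_zero, add_zero]
    rw [← coroot_sum_apply (θ := fun i => A i i) hA k]
    refine Finset.sum_congr rfl fun i _ => ?_
    split_ifs <;> simp
  · simp only [hkl, if_false, map_zero, mul_zero, Finset.sum_const_zero, zero_add]
    rw [Fintype.sum_eq_single ⟨(k, l), hkl⟩]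
    · simp
    · intro p hp
      rw [if_neg (fun h => hp (Subtype.ext h))]
      simp

theorem exists_charpoly_eq_prod (A : Matrix (Fin n) (Fin n) ℂ) :
    ∃ θ : Fin n → ℂ, A.charpoly = ∏ i, (Polynomial.X - Polynomial.C (θ i)) := by
  have h1 : ∀ s : Multiset ℂ, s.card = n → ∃ θ : Fin n → ℂ, Finset.univ.val.map θ = s := by
    intro s hs
    obtain ⟨l, rfl⟩ := Quot.exists_rep s
    have hl : l.length = n := hs
    subst hl
    exact ⟨l.get, by rw [Fin.univ_val_map, List.ofFn_get]; rfl⟩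
  obtain ⟨θ, hθ⟩ := h1 A.charpoly.roots (by
    rw [IsAlgClosed.card_roots_eq_natDegree, Matrix.charpoly_natDegree_eq_dim, Fintype.card_fin])
  refine ⟨θ, ?_⟩
  have h2 := (IsAlgClosed.splits A.charpoly).eq_prod_roots_of_monic (Matrix.charpoly_monic A)
  rw [h2, ← hθ, Multiset.map_map]
  rfl

end GenericMatrix

section SymmetricLift

variable {n : ℕ}

/-- By the fundamental theorem on symmetric polynomials, a symmetric polynomial of the eigenvalues
of `L` is a polynomial in the entries of `L`. -/
theorem exists_lift_of_isSymmetric (p : MvPolynomial (Fin n) (MvPolynomial (Var n) ℂ))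
    (hp : p.IsSymmetric) :
    ∃ P : MvPolynomial (Var n) ℂ, ∀ (R : Type) [CommRing R] [Algebra ℂ R] (z : Var n → R)
      (θ : Fin n → R), (matrixAt z).charpoly = ∏ i, (Polynomial.X - Polynomial.C (θ i)) →
        MvPolynomial.aeval z P =
          MvPolynomial.eval₂
            (MvPolynomial.aeval (R := ℂ) z : MvPolynomial (Var n) ℂ →+* R) θ p := by
  obtain ⟨q, hq⟩ := MvPolynomial.esymmAlgHom_surjective (σ := Fin n) (MvPolynomial (Var n) ℂ)
    (Fintype.card_fin n).le ⟨p, hp⟩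
  have hq' : MvPolynomial.aeval (fun i : Fin n => MvPolynomial.esymm (Fin n) _ (i + 1)) q = p := by
    rw [← MvPolynomial.esymmAlgHom_apply, hq]
  let c (i : Fin n) : MvPolynomial (Var n) ℂ :=
    (-1) ^ (i.1 + 1) * (matrixAt (MvPolynomial.X : Var n → MvPolynomial (Var n) ℂ)).charpoly.coeff
      (n - (i.1 + 1))
  refine ⟨MvPolynomial.eval c q, fun R _ _ z θ h => ?_⟩
  have h1 : (matrixAt z).charpoly = (matrixAt (MvPolynomial.X : Var n → _)).charpoly.map
      (MvPolynomial.aeval (R := ℂ) z : MvPolynomial (Var n) ℂ →+* R) := by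
    rw [← Matrix.charpoly_map]
    congr 1
    have := matrixAt_map (MvPolynomial.aeval (R := ℂ) z)
      (MvPolynomial.X : Var n → MvPolynomial (Var n) ℂ)
    simp only [MvPolynomial.aeval_X] at this
    exact this.symm
  have h2 (i : Fin n) : MvPolynomial.aeval (R := ℂ) z (c i) = MvPolynomial.eval₂
      (MvPolynomial.aeval (R := ℂ) z : MvPolynomial (Var n) ℂ →+* R) θ
      (MvPolynomial.esymm (Fin n) (MvPolynomial (Var n) ℂ) (i + 1)) := by
    have h3 : MvPolynomial.aeval (R := ℂ) z
        ((matrixAt (MvPolynomial.X : Var n → MvPolynomial (Var n) ℂ)).charpoly.coeff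
        (n - (i.1 + 1))) = (matrixAt z).charpoly.coeff (n - (i.1 + 1)) := by
      rw [h1, Polynomial.coeff_map]
      rfl
    rw [map_mul, map_pow, map_neg, map_one, h3, h, MvPolynomial.eval₂_eq_eval_map,
      MvPolynomial.map_esymm, ← MvPolynomial.aeval_eq_eval,
      MvPolynomial.aeval_esymm_eq_multiset_esymm]
    have h4 := Multiset.prod_X_sub_C_coeff (Multiset.map θ Finset.univ.val) (k := n - (i.1 + 1))
      (by simp)
    rw [Multiset.map_map] at h4
    have h5 : n - (n - (i.1 + 1)) = i.1 + 1 := by omega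
    simp only [Multiset.card_map, Finset.card_val, Finset.card_univ, Fintype.card_fin, h5] at h4
    rw [Finset.prod_eq_multiset_prod]
    refine (congrArg _ h4).trans ?_
    rw [← mul_assoc, ← mul_pow]
    simp
  rw [← hq']
  clear hq hq'
  induction q using MvPolynomial.induction_on with
  | C a => simp
  | add p q hp hq => rw [map_add, map_add, hp, hq, map_add, MvPolynomial.eval₂_add]
  | mul_X p i hp =>
    rw [map_mul, map_mul, hp, map_mul, MvPolynomial.eval₂_mul, MvPolynomial.eval_X,
      MvPolynomial.aeval_X, h2]

theorem linForm_map {R S : Type*} [CommRing R] [Algebra ℂ R] [CommRing S] [Algebra ℂ S]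
    (f : R →ₐ[ℂ] S) (ν : Module.Dual ℂ (cartan n)) (θ : Fin n → R) :
    f (linForm ν θ) = linForm ν fun i => f (θ i) := by
  simp [linForm]

variable [NeZero n]

/-- Products over a Weyl orbit are symmetric in the eigenvalues. -/
theorem prod_orbit_comp {R S : Type*} [CommRing R] [Algebra ℂ R] [CommMonoid S]
    (μ : Module.Dual ℂ (cartan n)) (σ : Equiv.Perm (Fin n)) (θ : Fin n → R) (F : R → S) :
    ∏ ν ∈ (weylOrbit_finite μ).toFinset, F (linForm ν (θ ∘ σ)) =
      ∏ ν ∈ (weylOrbit_finite μ).toFinset, F (linForm ν θ) := by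
  have h (τ : Equiv.Perm (Fin n)) (ν : Module.Dual ℂ (cartan n)) :
      permute τ.symm (permute τ ν) = ν := by
    apply coef_injective
    rw [coef_permute, coef_permute]
    ext i
    simp
  refine Finset.prod_nbij' (permute σ.symm) (permute σ) ?_ ?_ ?_ ?_ ?_
  · intro ν hν
    rw [Set.Finite.mem_toFinset] at hν ⊢
    exact permute_mem_weylOrbit hν _
  · intro ν hν
    rw [Set.Finite.mem_toFinset] at hν ⊢
    exact permute_mem_weylOrbit hν _
  · exact fun ν _ => h σ.symm ν
  · exact fun ν _ => h σ ν
  · intro ν _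
    rw [linForm_permute]
    rfl

theorem exists_orbital_polynomial (μ : Module.Dual ℂ (cartan n)) :
    ∃ P : MvPolynomial (Var n) ℂ, ∀ (R : Type) [CommRing R] [Algebra ℂ R] (z : Var n → R)
      (θ : Fin n → R), (matrixAt z).charpoly = ∏ i, (Polynomial.X - Polynomial.C (θ i)) →
        MvPolynomial.aeval z P = ∏ ν ∈ (weylOrbit_finite μ).toFinset, (z none + linForm ν θ) := by
  obtain ⟨P, hP⟩ := exists_lift_of_isSymmetric (n := n)
    (∏ ν ∈ (weylOrbit_finite μ).toFinset,
      (MvPolynomial.C (MvPolynomial.X none) + linForm ν MvPolynomial.X)) (by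
    intro σ
    rw [map_prod, ← prod_orbit_comp μ σ]
    refine Finset.prod_congr rfl fun ν _ => ?_
    rw [map_add, MvPolynomial.rename_C]
    congr 1
    refine (linForm_map (AlgHom.restrictScalars ℂ
      (MvPolynomial.rename (R := MvPolynomial (Var n) ℂ) σ)) ν MvPolynomial.X).trans ?_
    simp only [AlgHom.restrictScalars_apply, MvPolynomial.rename_X]
    rfl)
  refine ⟨P, fun R _ _ z θ h => ?_⟩
  rw [hP R z θ h, ← MvPolynomial.coe_eval₂Hom, map_prod]
  refine Finset.prod_congr rfl fun ν _ => ?_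
  rw [map_add, MvPolynomial.coe_eval₂Hom, MvPolynomial.eval₂_C]
  congr 1
  · simp
  · rw [linForm, linForm, ← MvPolynomial.coe_eval₂Hom, map_sum]
    refine Finset.sum_congr rfl fun i _ => ?_
    rw [Algebra.smul_def, map_mul, Algebra.smul_def, MvPolynomial.algebraMap_apply]
    simp

/-- The orbital factor of `μ`: a polynomial whose value is `∏_{ν ∈ O_μ} (z₀ + ν(θ))` at every point
of every commutative `ℂ`-algebra at which `L` has eigenvalues `θ`. -/
noncomputable def orbitalFactor (μ : Module.Dual ℂ (cartan n)) : MvPolynomial (Var n) ℂ :=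
  (exists_orbital_polynomial μ).choose

theorem aeval_orbitalFactor (μ : Module.Dual ℂ (cartan n)) {R : Type} [CommRing R] [Algebra ℂ R]
    (z : Var n → R) (θ : Fin n → R)
    (h : (matrixAt z).charpoly = ∏ i, (Polynomial.X - Polynomial.C (θ i))) :
    MvPolynomial.aeval z (orbitalFactor μ) =
      ∏ ν ∈ (weylOrbit_finite μ).toFinset, (z none + linForm ν θ) :=
  (exists_orbital_polynomial μ).choose_spec R z θ h

theorem eval_orbitalFactor (μ : Module.Dual ℂ (cartan n)) (z : Var n → ℂ) (θ : Fin n → ℂ)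
    (h : (elementAt z).1.charpoly = ∏ i, (Polynomial.X - Polynomial.C (θ i))) :
    MvPolynomial.eval z (orbitalFactor μ) =
      ∏ ν ∈ (weylOrbit_finite μ).toFinset, (z none + linForm ν θ) := by
  rw [← matrixAt_eq_elementAt] at h
  rw [← MvPolynomial.aeval_eq_eval]
  exact aeval_orbitalFactor μ z θ h

theorem isOrbitalFactor_iff (μ : Module.Dual ℂ (cartan n)) (P : MvPolynomial (Var n) ℂ) :
    IsOrbitalFactor μ P ↔ P = orbitalFactor μ := by
  have h1 (z : Var n → ℂ) (θ : Fin n → ℂ)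
      (h : (elementAt z).1.charpoly = ∏ i, (Polynomial.X - Polynomial.C (θ i))) :
      ∏ᶠ ν ∈ weylOrbit μ, (z none + ν (diagElement θ)) =
        MvPolynomial.eval z (orbitalFactor μ) := by
    rw [eval_orbitalFactor μ z θ h, finprod_mem_eq_finite_toFinset_prod _ (weylOrbit_finite μ)]
    simp only [apply_diagElement _ (sum_eq_zero_of_charpoly (trace_coe _) h)]
  constructor
  · intro hP
    refine MvPolynomial.funext fun z => ?_
    obtain ⟨θ, hθ⟩ := exists_charpoly_eq_prod (elementAt z).1
    rw [hP z θ hθ, h1 z θ hθ]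
  · rintro rfl z θ h
    rw [h1 z θ h]

end SymmetricLift

end SlCharPoly

/-! ### Irreducibility of the orbital factors and the factorization -/

namespace SlCharPoly

section Companion

variable {n : ℕ} {R : Type*} [CommRing R]

/-- The monic polynomial with roots `θ`. -/
noncomputable def rootPoly (θ : Fin n → R) : Polynomial R :=
  ∏ i, (Polynomial.X - Polynomial.C (θ i))

/-- The companion matrix of the monic polynomial with roots `θ`. -/
noncomputable def companion (θ : Fin n → R) : Matrix (Fin n) (Fin n) R :=
  Matrix.of fun k j =>
    if j.1 + 1 = n then -(rootPoly θ).coeff k else if k.1 = j.1 + 1 then 1 else 0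

theorem vandermonde_mul_companion (θ : Fin n → R) :
    Matrix.vandermonde θ * companion θ = Matrix.diagonal θ * Matrix.vandermonde θ := by
  nontriviality R
  ext i j
  rw [Matrix.diagonal_mul, Matrix.mul_apply, Matrix.vandermonde_apply]
  simp only [Matrix.vandermonde_apply, companion, Matrix.of_apply]
  split_ifs with hj
  · have h1 : (rootPoly θ).eval (θ i) = 0 := by
      rw [rootPoly, Polynomial.eval_prod]
      exact Finset.prod_eq_zero (Finset.mem_univ i) (by simp)
    have hd : (rootPoly θ).natDegree = n := by
      rw [rootPoly, Polynomial.natDegree_prod_of_monic _ _ fun i _ => Polynomial.monic_X_sub_C _]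
      simp
    have hm : (rootPoly θ).Monic := Polynomial.monic_prod_of_monic _ _ fun i _ =>
      Polynomial.monic_X_sub_C _
    rw [Polynomial.eval_eq_sum_range, hd, Finset.sum_range_succ] at h1
    have h2 : (rootPoly θ).coeff n = 1 := by
      have := hm.coeff_natDegree
      rwa [hd] at this
    rw [h2, one_mul, ← Fin.sum_univ_eq_sum_range (fun k => (rootPoly θ).coeff k * θ i ^ k)] at h1
    rw [← pow_succ', hj, eq_neg_of_add_eq_zero_right h1, ← Finset.sum_neg_distrib]
    exact Finset.sum_congr rfl fun k _ => by ring
  · have hj' : j.1 + 1 < n := by omega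
    rw [Fintype.sum_eq_single ⟨j.1 + 1, hj'⟩]
    · simp [pow_succ']
    · intro k hk
      rw [if_neg (fun h => hk (Fin.ext h)), mul_zero]

/-- The Vandermonde matrix conjugates the companion matrix to the diagonal one. -/
theorem charpoly_companion [IsDomain R] {θ : Fin n → R} (hθ : Function.Injective θ) :
    (companion θ).charpoly = ∏ i, (Polynomial.X - Polynomial.C (θ i)) := by
  rw [← Matrix.charpoly_diagonal]
  have hV : (Matrix.vandermonde θ).det ≠ 0 := Matrix.det_vandermonde_ne_zero_iff.2 hθ
  set V := (Polynomial.C : R →+* Polynomial R).mapMatrix (Matrix.vandermonde θ) with hVdef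
  have hV' : V.det ≠ 0 := by
    rw [hVdef, ← RingHom.map_det]
    simpa using hV
  have h1 : V * Matrix.charmatrix (companion θ) =
      Matrix.charmatrix (Matrix.diagonal θ) * V := by
    rw [Matrix.charmatrix, Matrix.charmatrix, mul_sub, sub_mul, hVdef, ← map_mul, ← map_mul,
      vandermonde_mul_companion, Matrix.scalar_commute _ (fun r => Commute.all _ r)]
  have h2 := congrArg Matrix.det h1
  rw [Matrix.det_mul, Matrix.det_mul, mul_comm] at h2
  exact mul_right_cancel₀ hV' h2

theorem companion_map {S : Type*} [CommRing S] (f : R →+* S) (θ : Fin n → R) :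
    (companion θ).map f = companion (f ∘ θ) := by
  ext i j
  have h : (rootPoly (f ∘ θ)).coeff i = f ((rootPoly θ).coeff i) := by
    rw [← Polynomial.coeff_map]
    congr 1
    simp [rootPoly, Polynomial.map_prod]
  simp only [companion, Matrix.map_apply, Matrix.of_apply, h]
  split_ifs <;> simp

/-- The companion matrix depends only on the unordered family of eigenvalues. -/
theorem companion_comp_perm (θ : Fin n → R) (σ : Equiv.Perm (Fin n)) :
    companion (θ ∘ σ) = companion θ := by
  have h : rootPoly (θ ∘ σ) = rootPoly θ :=
    Equiv.prod_comp σ fun i => Polynomial.X - Polynomial.C (θ i)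
  simp only [companion, h]

theorem trace_companion [IsDomain R] {θ : Fin n → R} (hθ : Function.Injective θ)
    (hsum : ∑ i, θ i = 0) : (companion θ).trace = 0 := by
  obtain _ | n := n
  · simp
  rw [Matrix.trace_eq_neg_charpoly_coeff, charpoly_companion hθ, ← Matrix.charpoly_diagonal,
    ← Matrix.trace_eq_neg_charpoly_coeff, Matrix.trace_diagonal, hsum]

theorem coords_map {S : Type*} [CommRing S] (f : R →+* S) (A : Matrix (Fin n) (Fin n) R)
    (b : ChevIndex n) : coords (A.map f) b = f (coords A b) := by
  rcases b with i | p
  · simp [coords]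
  · simp [coords]

end Companion

section Degree

variable {n : ℕ}

theorem charpoly_smul_eq {A : Matrix (Fin n) (Fin n) ℂ} {θ : Fin n → ℂ}
    (h : A.charpoly = ∏ i, (Polynomial.X - Polynomial.C (θ i))) (t : ℂ) :
    (t • A).charpoly = ∏ i, (Polynomial.X - Polynomial.C (t * θ i)) := by
  rcases eq_or_ne t 0 with rfl | ht
  · simp [Matrix.charpoly_zero]
  · refine Polynomial.funext fun y => ?_
    have h1 : Matrix.scalar (Fin n) y - t • A = t • (Matrix.scalar (Fin n) (y / t) - A) := by
      rw [smul_sub]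
      congr 1
      ext i j
      simp only [Matrix.scalar_apply, Matrix.smul_apply, Matrix.diagonal_apply]
      split_ifs
      · rw [smul_eq_mul, mul_div_cancel₀ _ ht]
      · simp
    rw [Matrix.eval_charpoly, h1, Matrix.det_smul, ← Matrix.eval_charpoly, h, Polynomial.eval_prod,
      Polynomial.eval_prod, Fintype.card_fin, ← Fin.prod_const, ← Finset.prod_mul_distrib]
    refine Finset.prod_congr rfl fun i _ => ?_
    simp only [Polynomial.eval_sub, Polynomial.eval_X, Polynomial.eval_C, mul_sub]
    rw [mul_div_cancel₀ _ ht]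

/-- Along the line through `z` the homogeneous components of a polynomial become the
coefficients. -/
theorem coeff_aeval_line {σ : Type*} (z : σ → ℂ) (f : MvPolynomial σ ℂ) (d : ℕ) :
    (MvPolynomial.aeval (fun b => Polynomial.C (z b) * Polynomial.X) f : Polynomial ℂ).coeff d =
      MvPolynomial.eval z (MvPolynomial.homogeneousComponent d f) := by
  induction f using MvPolynomial.induction_on' with
  | monomial u a =>
    rw [MvPolynomial.aeval_monomial, MvPolynomial.homogeneousComponent_of_mem
      (MvPolynomial.isHomogeneous_monomial a (n := u.degree) rfl), Finsupp.prod]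
    simp only [mul_pow, Finset.prod_mul_distrib, ← Polynomial.C_pow, ← map_prod]
    rw [Finset.prod_pow_eq_pow_sum, Polynomial.algebraMap_apply, Algebra.algebraMap_self_apply,
      ← mul_assoc, ← Polynomial.C_mul, Polynomial.coeff_C_mul_X_pow]
    have hdeg : u.degree = ∑ i ∈ u.support, u i := rfl
    rw [← hdeg]
    split_ifs with h
    · rw [MvPolynomial.eval_monomial]
      rfl
    · simp
  | add p q hp hq => rw [map_add, Polynomial.coeff_add, hp, hq, map_add, map_add]

theorem totalDegree_le_of_homogeneous {σ : Type*} {f : MvPolynomial σ ℂ} {N : ℕ}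
    (h : ∀ (z : σ → ℂ) (t : ℂ), MvPolynomial.eval (fun b => t * z b) f =
      t ^ N * MvPolynomial.eval z f) : f.totalDegree ≤ N := by
  have h1 (d : ℕ) (hd : d ≠ N) : MvPolynomial.homogeneousComponent d f = 0 := by
    refine MvPolynomial.funext fun z => ?_
    have h2 : (MvPolynomial.aeval (fun b => Polynomial.C (z b) * Polynomial.X) f : Polynomial ℂ) =
        Polynomial.C (MvPolynomial.eval z f) * Polynomial.X ^ N := by
      refine Polynomial.funext fun t => ?_
      have h3 : (MvPolynomial.aeval (fun b => Polynomial.C (z b) * Polynomial.X) f :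
          Polynomial ℂ).eval t = MvPolynomial.eval (fun b => t * z b) f := by
        rw [← Polynomial.coe_aeval_eq_eval, MvPolynomial.comp_aeval_apply,
          ← MvPolynomial.aeval_eq_eval]
        simp only [map_mul, Polynomial.aeval_C, Polynomial.aeval_X, Algebra.algebraMap_self_apply,
          mul_comm t]
      rw [h3, h, Polynomial.eval_mul, Polynomial.eval_C, Polynomial.eval_pow, Polynomial.eval_X,
        mul_comm]
    rw [← coeff_aeval_line, h2, Polynomial.coeff_C_mul_X_pow, if_neg hd, map_zero]
  refine Finset.sup_le fun m hm => ?_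
  by_contra hlt
  have h4 := congrArg (MvPolynomial.coeff m) (h1 m.degree fun heq => hlt (le_of_eq heq))
  rw [MvPolynomial.coeff_homogeneousComponent, if_pos rfl, MvPolynomial.coeff_zero] at h4
  exact MvPolynomial.mem_support_iff.1 hm h4

theorem elementAt_smul (z : Var n → ℂ) (t : ℂ) :
    (elementAt fun b => t * z b).1 = t • (elementAt z).1 := by
  have : elementAt (fun b => t * z b) = t • elementAt z := by
    simp only [elementAt, Finset.smul_sum, mul_smul]
  rw [this]
  rfl

variable [NeZero n]

theorem card_orbit (μ : Module.Dual ℂ (cartan n)) :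
    (weylOrbit_finite μ).toFinset.card = (weylOrbit μ).ncard :=
  (Set.ncard_eq_toFinset_card _ _).symm

theorem totalDegree_orbitalFactor_le (μ : Module.Dual ℂ (cartan n)) :
    (orbitalFactor μ).totalDegree ≤ (weylOrbit μ).ncard := by
  refine totalDegree_le_of_homogeneous fun z t => ?_
  obtain ⟨θ, hθ⟩ := exists_charpoly_eq_prod (elementAt z).1
  have h1 := charpoly_smul_eq hθ t
  rw [← elementAt_smul] at h1
  rw [eval_orbitalFactor μ _ _ h1, eval_orbitalFactor μ _ _ hθ, ← card_orbit, ← Finset.prod_const,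
    ← Finset.prod_mul_distrib]
  refine Finset.prod_congr rfl fun ν _ => ?_
  simp only [linForm, mul_add, Finset.mul_sum, smul_eq_mul]
  congr 1
  exact Finset.sum_congr rfl fun i _ => by ring

end Degree

section Irreducible

variable {n : ℕ}

theorem aeval_none_eq_map {R : Type*} [CommRing R] [Algebra ℂ R] (w : ChevIndex n → R)
    {z : Var n → Polynomial R} (h0 : z none = Polynomial.X)
    (hz : ∀ b, z (some b) = Polynomial.C (w b)) (P : MvPolynomial (Var n) ℂ) :
    MvPolynomial.aeval z P = (MvPolynomial.optionEquivLeft ℂ (ChevIndex n) P).map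
      (MvPolynomial.aeval (R := ℂ) w : MvPolynomial (ChevIndex n) ℂ →+* R) := by
  induction P using MvPolynomial.induction_on with
  | C a =>
    rw [MvPolynomial.optionEquivLeft_C]
    simp
  | add p q hp hq => rw [map_add, map_add, Polynomial.map_add, hp, hq]
  | mul_X p b hp =>
    rw [map_mul, map_mul, Polynomial.map_mul, hp]
    congr 1
    rcases b with _ | b
    · simp [h0]
    · simp [hz]

theorem natDegree_aeval_le {R : Type*} [CommRing R] [Algebra ℂ R] (w : ChevIndex n → R)
    {z : Var n → Polynomial R} (h0 : z none = Polynomial.X)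
    (hz : ∀ b, z (some b) = Polynomial.C (w b)) (P : MvPolynomial (Var n) ℂ) :
    (MvPolynomial.aeval z P).natDegree ≤ P.degreeOf none := by
  rw [aeval_none_eq_map w h0 hz, ← MvPolynomial.natDegree_optionEquivLeft]
  exact Polynomial.natDegree_map_le

/-- Generic eigenvalues of a trace-free matrix: the centred variables. -/
noncomputable def genericEigenvalue (n : ℕ) (i : Fin n) : MvPolynomial (Fin n) ℂ :=
  MvPolynomial.X i - (n : ℂ)⁻¹ • ∑ j, MvPolynomial.X j

theorem genericEigenvalue_injective : Function.Injective (genericEigenvalue n) := by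
  intro i j h
  simpa [genericEigenvalue] using h

theorem rename_genericEigenvalue (σ : Equiv.Perm (Fin n)) :
    MvPolynomial.rename σ ∘ genericEigenvalue n = genericEigenvalue n ∘ σ := by
  ext1 i
  simp only [Function.comp_apply, genericEigenvalue, map_sub, map_smul, map_sum,
    MvPolynomial.rename_X]
  rw [Equiv.sum_comp σ (fun j => (MvPolynomial.X j : MvPolynomial (Fin n) ℂ))]

theorem linForm_genericEigenvalue (ν : Module.Dual ℂ (cartan n)) :
    linForm ν (genericEigenvalue n) =
      linForm ν (MvPolynomial.X : Fin n → MvPolynomial (Fin n) ℂ) := by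
  simp only [linForm, genericEigenvalue, smul_sub, Finset.sum_sub_distrib]
  rw [← Finset.sum_smul, sum_coef, zero_smul, sub_zero]

/-- The point of the space of trace-free matrices given by the generic companion matrix, with `z₀`
a further indeterminate. -/
noncomputable def genericPoint (n : ℕ) : Var n → Polynomial (MvPolynomial (Fin n) ℂ)
  | none => Polynomial.X
  | some b => Polynomial.C (coords (companion (genericEigenvalue n)) b)

/-- The generic companion matrix is fixed by permutations of the eigenvalues. -/
theorem map_rename_aeval_genericPoint (σ : Equiv.Perm (Fin n)) (P : MvPolynomial (Var n) ℂ) :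
    (MvPolynomial.aeval (genericPoint n) P).map
        (MvPolynomial.rename (R := ℂ) σ : MvPolynomial (Fin n) ℂ →+* MvPolynomial (Fin n) ℂ) =
      MvPolynomial.aeval (genericPoint n) P := by
  have h1 : ∀ b, (genericPoint n b).map
      (MvPolynomial.rename (R := ℂ) σ : MvPolynomial (Fin n) ℂ →+* MvPolynomial (Fin n) ℂ) =
        genericPoint n b := by
    rintro (_ | b)
    · simp [genericPoint]
    · rw [genericPoint, Polynomial.map_C, ← coords_map, companion_map]
      have h2 := rename_genericEigenvalue σ
      have h3 : (MvPolynomial.rename (R := ℂ) σ :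
          MvPolynomial (Fin n) ℂ →+* MvPolynomial (Fin n) ℂ) ∘ genericEigenvalue n =
            genericEigenvalue n ∘ σ := h2
      rw [h3, companion_comp_perm]
  induction P using MvPolynomial.induction_on with
  | C a => simp
  | add p q hp hq => rw [map_add, Polynomial.map_add, hp, hq]
  | mul_X p b hp => rw [map_mul, Polynomial.map_mul, hp, MvPolynomial.aeval_X, h1]

theorem natDegree_aeval_genericPoint_le (P : MvPolynomial (Var n) ℂ) :
    (MvPolynomial.aeval (genericPoint n) P).natDegree ≤ P.degreeOf none :=
  natDegree_aeval_le (coords (companion (genericEigenvalue n))) rfl (fun _ => rfl) P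

variable [NeZero n]

theorem sum_genericEigenvalue : ∑ i, genericEigenvalue n i = 0 := by
  simp only [genericEigenvalue, Finset.sum_sub_distrib, Finset.sum_const, Finset.card_univ,
    Fintype.card_fin]
  rw [← Nat.cast_smul_eq_nsmul ℂ, smul_smul, mul_inv_cancel₀ card_ne_zero, one_smul, sub_self]

theorem linForm_X_injective :
    Function.Injective fun ν : Module.Dual ℂ (cartan n) =>
      linForm ν (MvPolynomial.X : Fin n → MvPolynomial (Fin n) ℂ) := by
  intro ν ν' h
  apply coef_injective
  ext i
  have h1 := congrArg (MvPolynomial.eval (Pi.single i 1)) h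
  simpa [linForm, MvPolynomial.smul_eval, Pi.single_apply] using h1

theorem aeval_genericPoint_orbitalFactor (μ : Module.Dual ℂ (cartan n)) :
    MvPolynomial.aeval (genericPoint n) (orbitalFactor μ) =
      ∏ ν ∈ (weylOrbit_finite μ).toFinset,
        (Polynomial.X + Polynomial.C (linForm ν MvPolynomial.X)) := by
  set A := (companion (genericEigenvalue n)).map
    (Polynomial.C : MvPolynomial (Fin n) ℂ →+* Polynomial (MvPolynomial (Fin n) ℂ)) with hA
  have h1 : matrixAt (genericPoint n) = A := by
    refine matrixAt_of_coords ?_ fun b => (coords_map _ _ b).symm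
    rw [hA, ← AddMonoidHom.map_trace, trace_companion genericEigenvalue_injective
      sum_genericEigenvalue, map_zero]
  rw [aeval_orbitalFactor μ (genericPoint n) (fun i => Polynomial.C (genericEigenvalue n i))]
  · refine Finset.prod_congr rfl fun ν _ => ?_
    rw [← linForm_genericEigenvalue]
    congr 1
    exact (linForm_map (Polynomial.CAlgHom (R := ℂ) (A := MvPolynomial (Fin n) ℂ)) ν _).symm
  · rw [h1, hA, Matrix.charpoly_map, charpoly_companion genericEigenvalue_injective,
      Polynomial.map_prod]
    simp

/-- A polynomial at the generic companion matrix which has one of the roots of the orbital factor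
has all of them: permuting the eigenvalues fixes the polynomial and permutes the roots
transitively. -/
theorem ncard_le_natDegree_of_isRoot (μ : Module.Dual ℂ (cartan n)) {P : MvPolynomial (Var n) ℂ}
    (hP : MvPolynomial.aeval (genericPoint n) P ≠ 0)
    (hroot : (MvPolynomial.aeval (genericPoint n) P).IsRoot (-linForm μ MvPolynomial.X)) :
    (weylOrbit μ).ncard ≤ (MvPolynomial.aeval (genericPoint n) P).natDegree := by
  classical
  have h1 : ∀ ν ∈ (weylOrbit_finite μ).toFinset,
      (MvPolynomial.aeval (genericPoint n) P).IsRoot (-linForm ν MvPolynomial.X) := by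
    intro ν hν
    rw [Set.Finite.mem_toFinset] at hν
    obtain ⟨σ, rfl⟩ := exists_permute_eq (MulAction.mem_orbit_self μ) hν
    have h2 := hroot.map (f := (MvPolynomial.rename (R := ℂ) σ.symm :
      MvPolynomial (Fin n) ℂ →+* MvPolynomial (Fin n) ℂ))
    rw [map_rename_aeval_genericPoint, map_neg] at h2
    rw [linForm_permute]
    have h3 := linForm_map (MvPolynomial.rename (R := ℂ) σ.symm) μ MvPolynomial.X
    simp only [MvPolynomial.rename_X] at h3
    exact h3 ▸ h2
  have h4 : ((weylOrbit_finite μ).toFinset.image fun ν =>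
      -linForm ν (MvPolynomial.X : Fin n → MvPolynomial (Fin n) ℂ)).card = (weylOrbit μ).ncard := by
    rw [Finset.card_image_of_injective _ fun a b hab => linForm_X_injective (neg_injective hab),
      card_orbit]
  rw [← h4]
  refine Polynomial.card_le_degree_of_subset_roots ?_
  intro x hx
  obtain ⟨ν, hν, rfl⟩ := Finset.mem_image.1 hx
  exact (Polynomial.mem_roots hP).2 (h1 ν hν)

theorem monic_aeval_genericPoint (μ : Module.Dual ℂ (cartan n)) :
    (MvPolynomial.aeval (genericPoint n) (orbitalFactor μ)).Monic := by
  rw [aeval_genericPoint_orbitalFactor]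
  exact Polynomial.monic_prod_of_monic _ _ fun ν _ => Polynomial.monic_X_add_C _

theorem ncard_le_degreeOf (μ : Module.Dual ℂ (cartan n)) :
    (weylOrbit μ).ncard ≤ (orbitalFactor μ).degreeOf none := by
  refine le_trans (le_of_eq ?_) (natDegree_aeval_genericPoint_le _)
  rw [aeval_genericPoint_orbitalFactor,
    Polynomial.natDegree_prod_of_monic _ _ fun ν _ => Polynomial.monic_X_add_C _]
  simp only [Polynomial.natDegree_X_add_C, Finset.sum_const, card_orbit, smul_eq_mul, mul_one]

theorem degreeOf_orbitalFactor (μ : Module.Dual ℂ (cartan n)) :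
    (orbitalFactor μ).degreeOf none = (weylOrbit μ).ncard :=
  le_antisymm ((MvPolynomial.degreeOf_le_totalDegree _ _).trans (totalDegree_orbitalFactor_le μ))
    (ncard_le_degreeOf μ)

theorem totalDegree_orbitalFactor (μ : Module.Dual ℂ (cartan n)) :
    (orbitalFactor μ).totalDegree = (weylOrbit μ).ncard :=
  le_antisymm (totalDegree_orbitalFactor_le μ)
    ((ncard_le_degreeOf μ).trans (MvPolynomial.degreeOf_le_totalDegree _ _))

theorem isUnit_of_totalDegree_eq_zero {σ : Type*} {P : MvPolynomial σ ℂ} (hP : P ≠ 0)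
    (h : P.totalDegree = 0) : IsUnit P := by
  rw [MvPolynomial.totalDegree_eq_zero_iff_eq_C] at h
  rw [h] at hP ⊢
  exact (isUnit_iff_ne_zero.2 fun h0 => hP (by rw [h0, map_zero])).map MvPolynomial.C

theorem irreducible_orbitalFactor (μ : Module.Dual ℂ (cartan n)) :
    Irreducible (orbitalFactor μ) := by
  have hpos : 0 < (weylOrbit μ).ncard :=
    (Set.ncard_pos (weylOrbit_finite μ)).2 ⟨μ, MulAction.mem_orbit_self μ⟩
  have hm := monic_aeval_genericPoint μ
  constructor
  · intro hu
    have h1 := (MvPolynomial.isUnit_iff_totalDegree_of_isReduced.1 hu).2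
    rw [totalDegree_orbitalFactor] at h1
    omega
  · intro P Q hPQ
    have hpq : MvPolynomial.aeval (genericPoint n) (orbitalFactor μ) =
        MvPolynomial.aeval (genericPoint n) P * MvPolynomial.aeval (genericPoint n) Q := by
      rw [hPQ, map_mul]
    have hp0 : MvPolynomial.aeval (genericPoint n) P ≠ 0 := fun h =>
      hm.ne_zero (by rw [hpq, h, zero_mul])
    have hq0 : MvPolynomial.aeval (genericPoint n) Q ≠ 0 := fun h =>
      hm.ne_zero (by rw [hpq, h, mul_zero])
    have hP0 : P ≠ 0 := fun h => hp0 (by rw [h, map_zero])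
    have hQ0 : Q ≠ 0 := fun h => hq0 (by rw [h, map_zero])
    have hdeg := MvPolynomial.totalDegree_mul_of_isDomain hP0 hQ0
    rw [← hPQ, totalDegree_orbitalFactor] at hdeg
    have hle (F : MvPolynomial (Var n) ℂ) :
        (MvPolynomial.aeval (genericPoint n) F).natDegree ≤ F.totalDegree :=
      (natDegree_aeval_genericPoint_le F).trans (MvPolynomial.degreeOf_le_totalDegree _ _)
    have hroot : (MvPolynomial.aeval (genericPoint n) P *
        MvPolynomial.aeval (genericPoint n) Q).IsRoot (-linForm μ MvPolynomial.X) := by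
      rw [← hpq, aeval_genericPoint_orbitalFactor, Polynomial.IsRoot, Polynomial.eval_prod]
      refine Finset.prod_eq_zero
        ((weylOrbit_finite μ).mem_toFinset.2 (MulAction.mem_orbit_self μ)) ?_
      simp
    -- A factor with one root has all of them, so the other factor is constant.
    rcases Polynomial.root_mul.1 hroot with h | h
    · right
      have h1 := (ncard_le_natDegree_of_isRoot μ hp0 h).trans (hle P)
      exact isUnit_of_totalDegree_eq_zero hQ0 (by omega)
    · left
      have h1 := (ncard_le_natDegree_of_isRoot μ hq0 h).trans (hle Q)
      exact isUnit_of_totalDegree_eq_zero hP0 (by omega)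

end Irreducible

section Factorization

variable {n : ℕ}

/-- There is a nonzero polynomial in the coordinates of `L` that vanishes as soon as `L` has a
multiple eigenvalue: the discriminant of its characteristic polynomial. -/
theorem exists_discriminant [NeZero n] :
    ∃ D : MvPolynomial (Var n) ℂ, D ≠ 0 ∧ ∀ (z : Var n → ℂ) (θ : Fin n → ℂ),
      (elementAt z).1.charpoly = ∏ i, (Polynomial.X - Polynomial.C (θ i)) →
        MvPolynomial.eval z D ≠ 0 → Function.Injective θ := by
  classical
  obtain ⟨D, hD⟩ := exists_lift_of_isSymmetric (n := n)
    (∏ p ∈ Finset.univ.offDiag, (MvPolynomial.X p.1 - MvPolynomial.X p.2)) (by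
    intro σ
    rw [map_prod]
    refine Finset.prod_equiv (σ.prodCongr σ) (by simp) ?_
    simp)
  have hD' (z : Var n → ℂ) (θ : Fin n → ℂ)
      (h : (elementAt z).1.charpoly = ∏ i, (Polynomial.X - Polynomial.C (θ i))) :
      MvPolynomial.eval z D = ∏ p ∈ Finset.univ.offDiag, (θ p.1 - θ p.2) := by
    rw [← matrixAt_eq_elementAt] at h
    rw [← MvPolynomial.aeval_eq_eval]
    refine (hD ℂ z θ h).trans ?_
    rw [← MvPolynomial.coe_eval₂Hom, map_prod]
    simp
  refine ⟨D, ?_, fun z θ h h0 i j hij => ?_⟩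
  -- A diagonal matrix of trace zero with distinct entries.
  · let θ : Fin n → ℂ := fun i => i.1 - (n : ℂ)⁻¹ * ∑ j : Fin n, (j.1 : ℂ)
    have hsum : ∑ i, θ i = 0 := by
      simp only [θ, Finset.sum_sub_distrib, Finset.sum_const, Finset.card_univ, Fintype.card_fin]
      rw [nsmul_eq_mul, mul_inv_cancel_left₀ card_ne_zero, sub_self]
    let z : Var n → ℂ := fun b => b.elim 0 (coords (Matrix.diagonal θ))
    have hz : (elementAt z).1.charpoly = ∏ i, (Polynomial.X - Polynomial.C (θ i)) := by
      rw [← matrixAt_eq_elementAt, matrixAt_of_coords (A := Matrix.diagonal θ)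
        (by rw [Matrix.trace_diagonal, hsum]) (fun b => rfl), Matrix.charpoly_diagonal]
    intro h0
    have h1 := hD' z θ hz
    rw [h0, map_zero, eq_comm, Finset.prod_eq_zero_iff] at h1
    obtain ⟨p, hp, hp'⟩ := h1
    refine (Finset.mem_offDiag.1 hp).2.2 (Fin.ext ?_)
    simpa [θ, sub_eq_zero] using hp'
  · by_contra hne
    apply h0
    rw [hD' z θ h]
    exact Finset.prod_eq_zero (i := (i, j)) (by simp [hne]) (by simp [hij])

variable {V : Type*} [AddCommGroup V] [Module ℂ V] [FiniteDimensional ℂ V]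
  (φ : LieAlgebra.SpecialLinear.sl (Fin n) ℂ →ₗ⁅ℂ⁆ Module.End ℂ V)

theorem eval_charPoly (z : Var n → ℂ) : MvPolynomial.eval z (charPoly φ) =
    LinearMap.det (z none • (LinearMap.id : V →ₗ[ℂ] V) + φ (elementAt z)) := by
  let b := Module.finBasis ℂ V
  rw [charPoly, ← LinearMap.det_toMatrix (Algebra.TensorProduct.basis (MvPolynomial (Var n) ℂ) b),
    RingHom.map_det, ← LinearMap.det_toMatrix b]
  congr 1
  have h1 : φ (elementAt z) = ∑ c : ChevIndex n, z (some c) • φ (chevVec c) := by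
    simp [elementAt]
  rw [h1]
  simp only [map_add, map_sum, map_smul, LinearMap.toMatrix_baseChange, LinearMap.toMatrix_id]
  ext i j
  simp only [RingHom.mapMatrix_apply, Matrix.map_apply, Matrix.add_apply,
    Matrix.sum_apply, Matrix.smul_apply, smul_eq_mul, map_mul, MvPolynomial.eval_X,
    Matrix.one_apply, MvPolynomial.algebraMap_eq, MvPolynomial.eval_C]
  split_ifs <;> simp

/-- Both sides agree at the elements with distinct eigenvalues, that is, where the discriminant does
not vanish. -/
theorem charPoly_eq_prod [NeZero n] : charPoly φ =
    ∏ μ ∈ (finite_dominantWeights φ).toFinset, orbitalFactor μ ^ weightMult φ μ := by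
  obtain ⟨D, hD0, hD⟩ := exists_discriminant (n := n)
  refine mul_left_cancel₀ hD0 (MvPolynomial.funext fun z => ?_)
  rw [map_mul, map_mul]
  rcases eq_or_ne (MvPolynomial.eval z D) 0 with h | h
  · rw [h, zero_mul, zero_mul]
  · congr 1
    obtain ⟨θ, hθ⟩ := exists_charpoly_eq_prod (elementAt z).1
    rw [eval_charPoly, det_map_of_charpoly φ _ _ (hD z θ hθ h) hθ, prod_weights_eq φ, map_prod]
    simp only [map_pow, eval_orbitalFactor _ z θ hθ]

end Factorization

end SlCharPoly

theorem theorem3p10 (n : ℕ) (hn : 2 ≤ n) (V : Type*) [AddCommGroup V] [Module ℂ V]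
    [FiniteDimensional ℂ V]
    (φ : LieAlgebra.SpecialLinear.sl (Fin n) ℂ →ₗ⁅ℂ⁆ Module.End ℂ V) :
    (SlCharPoly.dominantWeights φ).Finite ∧
    ∃ f : Module.Dual ℂ (SlCharPoly.cartan n) → MvPolynomial (SlCharPoly.Var n) ℂ,
      (∀ μ ∈ SlCharPoly.dominantWeights φ,
        (∀ P : MvPolynomial (SlCharPoly.Var n) ℂ, SlCharPoly.IsOrbitalFactor μ P ↔ P = f μ) ∧
        Irreducible (f μ) ∧
        (SlCharPoly.weylOrbit μ).Finite ∧
        (f μ).totalDegree = (SlCharPoly.weylOrbit μ).ncard ∧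
        (f μ).degreeOf none = (SlCharPoly.weylOrbit μ).ncard) ∧
      SlCharPoly.charPoly φ =
        ∏ᶠ μ ∈ SlCharPoly.dominantWeights φ, f μ ^ SlCharPoly.weightMult φ μ := by
  have : NeZero n := ⟨by omega⟩
  refine ⟨SlCharPoly.finite_dominantWeights φ, SlCharPoly.orbitalFactor, fun μ _ => ?_, ?_⟩
  · exact ⟨SlCharPoly.isOrbitalFactor_iff μ, SlCharPoly.irreducible_orbitalFactor μ,
      SlCharPoly.weylOrbit_finite μ, SlCharPoly.totalDegree_orbitalFactor μ,
      SlCharPoly.degreeOf_orbitalFactor μ⟩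
  · rw [finprod_mem_eq_finite_toFinset_prod _ (SlCharPoly.finite_dominantWeights φ)]
    exact SlCharPoly.charPoly_eq_prod φ
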